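/- Model. A cache-oblivious algorithm is a fixed program of a word RAM: finitely many word registers; addition, truncated subtraction, multiplication, division, remainder and comparisons on words; loads and stores in main memory; sequencing, conditionals and while loops. A word has $O(\lg(|V|+|E|))$ bits. Main memory is divided into aligned lines of $B$ words, and a cache holds at most $M/B$ lines. The number of I/Os of a run is its number of cache misses, starting from an empty cache and using optimal replacement (the ideal-cache model). The program, and hence its run, does not depend on $M$ and $B$. The input is a finite simple undirected unweighted graph $G=(V,E)$ with $V=\{0,\dots,n-1\}$, given by $n$, the lengths of the adjacency lists, and the concatenated adjacency lists, each in arbitrary order. Distances between vertices in different components are $\infty$. Theorem. For each of the following tasks there are a cache-oblivious algorithm and constants $c, C$ such that the algorithm performs the task on every graph $G$, and for all $B\ge 1$ and $M\ge cB$ it uses at most $$C\left(\frac{|E|^2}{MB}+\frac{|E|\lg|E|}{B}+\frac{|V|}{B}+1\right)$$ I/Os (with $|E|\lg|E|=0$ for $|E|=0$). Moreover, for every natural number $K$, if $|V|\le K|E|$, $|E|\ge 2$ and $B\le|E|$, then it uses at most $$C(K+1)\left(\frac{|E|^2}{MB}+\frac{|E|\lg|E|}{B}\right)$$ I/Os.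 The tasks are: 1. Return the array $T$ in which $T[i][j]$, for every vertex $i$ and $j\in\{0,1,2\}$, is the number of vertices at distance $\le j$ from $i$. 2. Return the array $S$ in which $S[i][j]$, for every vertex $i$ and $j\in\{0,1,2\}$, is the number of vertices at distance exactly $j$ from $i$, and $S[i][\ge 3]$ is the number of vertices at distance at least $3$ from $i$ (including those at distance $\infty$). 3. If $|V|\ge 2$, decide whether the diameter $\max_{u,v}d(u,v)$ of $G$ is $1$, $2$, or $\ge 3$. 4. If $|V|\ge 2$, decide whether the radius $\min_u\max_v d(u,v)$ of $G$ is $1$, $2$, or $\ge 3$. -/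

import Mathlib

namespace CacheOblivious

/-- The machine state of a word RAM: finitely many of the registers `reg 0, reg 1, …` are used by a
given program; `mem` is the main memory, an array of words. -/
structure State where
  reg : ℕ → ℕ
  mem : ℕ → ℕ

/-- The arithmetic and comparison operations on words. -/
inductive BinOp where
  | add | sub | mul | div | mod | lt | eq

/-- `sub` is truncated subtraction, comparisons return `0` or `1`. -/
def BinOp.eval : BinOp → ℕ → ℕ → ℕ
  | .add, a, b => a + b
  | .sub, a, b => a - b
  | .mul, a, b => a * b
  | .div, a, b => a / b
  | .mod, a, b => a % b
  | .lt, a, b => if a < b then 1 else 0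
  | .eq, a, b => if a = b then 1 else 0

/-- Programs of the word RAM. A program mentions neither the cache size nor the line size, and there
is no instruction that would reveal them. -/
inductive Prog where
  /-- Do nothing. -/
  | skip
  /-- `reg r := v` -/
  | const (r v : ℕ)
  /-- `reg r := f (reg a) (reg b)` -/
  | op (f : BinOp) (r a b : ℕ)
  /-- `reg r := mem[reg a]` -/
  | load (r a : ℕ)
  /-- `mem[reg a] := reg b` -/
  | store (a b : ℕ)
  /-- First `p`, then `q`. -/
  | seq (p q : Prog)
  /-- If `reg r ≠ 0` then `p` else `q`. -/
  | ite (r : ℕ) (p q : Prog)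
  /-- While `reg r ≠ 0` do `p`. -/
  | loop (r : ℕ) (p : Prog)

def State.setReg (s : State) (r v : ℕ) : State := { s with reg := Function.update s.reg r v }

def State.setMem (s : State) (a v : ℕ) : State := { s with mem := Function.update s.mem a v }

/-- `Exec W p s t s'`: on a machine whose words hold the numbers `0, …, W - 1`, the program `p`
started in state `s` halts in state `s'`, and `t` lists the addresses of the words of main memory
that it accesses, in order. A computation whose result does not fit in a word is stuck. -/
inductive Exec (W : ℕ) : Prog → State → List ℕ → State → Prop where
  | skip (s : State) : Exec W .skip s [] s
  | const (s : State) (r v : ℕ) (hv : v < W) : Exec W (.const r v) s [] (s.setReg r v)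
  | op (s : State) (f : BinOp) (r a b : ℕ) (hv : f.eval (s.reg a) (s.reg b) < W) :
      Exec W (.op f r a b) s [] (s.setReg r (f.eval (s.reg a) (s.reg b)))
  | load (s : State) (r a : ℕ) :
      Exec W (.load r a) s [s.reg a] (s.setReg r (s.mem (s.reg a)))
  | store (s : State) (a b : ℕ) :
      Exec W (.store a b) s [s.reg a] (s.setMem (s.reg a) (s.reg b))
  | seq {p q : Prog} {s₁ s₂ s₃ : State} {t₁ t₂ : List ℕ} (h₁ : Exec W p s₁ t₁ s₂)
      (h₂ : Exec W q s₂ t₂ s₃) : Exec W (.seq p q) s₁ (t₁ ++ t₂) s₃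
  | iteTrue {r : ℕ} {p q : Prog} {s s' : State} {t : List ℕ} (hr : s.reg r ≠ 0)
      (h : Exec W p s t s') : Exec W (.ite r p q) s t s'
  | iteFalse {r : ℕ} {p q : Prog} {s s' : State} {t : List ℕ} (hr : s.reg r = 0)
      (h : Exec W q s t s') : Exec W (.ite r p q) s t s'
  | loopStep {r : ℕ} {p : Prog} {s₁ s₂ s₃ : State} {t₁ t₂ : List ℕ} (hr : s₁.reg r ≠ 0)
      (h₁ : Exec W p s₁ t₁ s₂) (h₂ : Exec W (.loop r p) s₂ t₂ s₃) :
      Exec W (.loop r p) s₁ (t₁ ++ t₂) s₃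
  | loopDone {r : ℕ} {p : Prog} {s : State} (hr : s.reg r = 0) : Exec W (.loop r p) s [] s

/-- `Serves M B S t q`: a cache of `M` words, organised in lines of `B` words, which at present holds
the lines in `S`, can serve the memory accesses `t` with exactly `q` cache misses for some choice of
the lines to evict. Line `x` consists of the `B` words from address `x * B` on. On a miss the line
is brought in, after the eviction of any lines. (Each line that is written back has been
brought in before, so counting write-backs too would at most double the count, up to the lines left
in the cache at the end.) -/
inductive Serves (M B : ℕ) : Finset ℕ → List ℕ → ℕ → Prop where
  | nil (S : Finset ℕ) : Serves M B S [] 0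
  | hit {S : Finset ℕ} {a : ℕ} {t : List ℕ} {q : ℕ} (ha : a / B ∈ S) (h : Serves M B S t q) :
      Serves M B S (a :: t) q
  | miss {S S' : Finset ℕ} {a : ℕ} {t : List ℕ} {q : ℕ} (ha : a / B ∉ S) (ha' : a / B ∈ S')
      (hS : S' ⊆ insert (a / B) S) (hM : S'.card * B ≤ M) (h : Serves M B S' t q) :
      Serves M B S (a :: t) (q + 1)

/-- `adj i` lists the neighbours of vertex `i`, each once, in any order. -/
def IsAdjLists {n : ℕ} (G : SimpleGraph (Fin n)) (adj : Fin n → List (Fin n)) : Prop :=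
  ∀ i, (adj i).Nodup ∧ ∀ j, j ∈ adj i ↔ G.Adj i j

/-- The input: the number of vertices, the lengths of the adjacency lists, and the concatenated
adjacency lists. -/
def encode {n : ℕ} (adj : Fin n → List (Fin n)) : List ℕ :=
  n :: (List.ofFn (fun i => (adj i).length) ++
    (List.ofFn (fun i => (adj i).map (fun j => (j : ℕ)))).flatten)

/-- The initial state: the input stands at address `0`, everything else is zero. -/
def initState {n : ℕ} (adj : Fin n → List (Fin n)) : State where
  reg _ := 0
  mem a := (encode adj).getD a 0

/-- `|E|² / (M B) + |E| lg |E| / B` -/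
noncomputable def ioBound (e M B : ℕ) : ℝ :=
  (e : ℝ) ^ 2 / ((M : ℝ) * (B : ℝ)) + (e : ℝ) * Real.logb 2 (e : ℝ) / (B : ℝ)

/-- Some cache-oblivious algorithm, on words of `O(lg (|V| + |E|))` bits, started on the adjacency
lists of any graph `G`, halts in a state that satisfies `post`, and for every line size `B` and every
cache of `M` words with at least `c` lines it incurs, under optimal replacement from an empty cache,
at most `C * (|E|² / (M B) + |E| lg |E| / B + |V| / B + 1)` cache misses; the last two terms are
absorbed when `|V| ≤ K |E|`, `|E| ≥ 2` and `B ≤ |E|`. The program, its run and its memory accesses do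
not depend on `M` and `B`. -/
def CacheObliviouslySolvable (post : (n : ℕ) → SimpleGraph (Fin n) → State → Prop) : Prop :=
  ∃ (P : Prog) (k c C : ℕ), ∀ (n : ℕ) (G : SimpleGraph (Fin n)) (adj : Fin n → List (Fin n)),
    IsAdjLists G adj →
    ∃ (t : List ℕ) (s : State),
      Exec ((n + G.edgeSet.ncard + 2) ^ k) P (initState adj) t s ∧ post n G s ∧
      ∀ M B : ℕ, 1 ≤ B → c * B ≤ M →
        ∃ q : ℕ, Serves M B ∅ t q ∧
          (q : ℝ) ≤ C * (ioBound G.edgeSet.ncard M B + (n : ℝ) / (B : ℝ) + 1) ∧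
          ∀ K : ℕ, n ≤ K * G.edgeSet.ncard → 2 ≤ G.edgeSet.ncard → B ≤ G.edgeSet.ncard →
            (q : ℝ) ≤ C * ((K : ℝ) + 1) * ioBound G.edgeSet.ncard M B

/-- The array `T`, stored row by row from the address in register `0` on: `T[i][j]`, `j = 0, 1, 2`,
is the number of vertices at distance at most `j` from `i`. -/
def ReturnsT (n : ℕ) (G : SimpleGraph (Fin n)) (s : State) : Prop :=
  ∀ (i : Fin n) (j : Fin 3),
    s.mem (s.reg 0 + 3 * (i : ℕ) + (j : ℕ)) = {v : Fin n | G.edist i v ≤ ((j : ℕ) : ℕ∞)}.ncard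

/-- The array `S`, stored row by row from the address in register `0` on: `S[i][j]`, `j = 0, 1, 2`,
is the number of vertices at distance exactly `j` from `i`, and the last column counts the vertices
at distance at least `3`, unreachable ones included. -/
def ReturnsS (n : ℕ) (G : SimpleGraph (Fin n)) (s : State) : Prop :=
  ∀ i : Fin n,
    (∀ j : Fin 3,
      s.mem (s.reg 0 + 4 * (i : ℕ) + (j : ℕ)) = {v : Fin n | G.edist i v = ((j : ℕ) : ℕ∞)}.ncard) ∧
    s.mem (s.reg 0 + 4 * (i : ℕ) + 3) = {v : Fin n | 3 ≤ G.edist i v}.ncard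

/-- Register `0` tells whether `x` is `1`, `2` or at least `3`. -/
def Returns123 (x : ℕ∞) (s : State) : Prop :=
  (x = 1 ∧ s.reg 0 = 1) ∨ (x = 2 ∧ s.reg 0 = 2) ∨ (3 ≤ x ∧ s.reg 0 = 3)

end CacheOblivious

/-!
Two vertices are at distance at most `2` if and only if their closed neighbourhoods meet, so it
suffices to count, for each vertex `i`, the vertices `k` whose closed neighbourhood meets that of
`i`. An isolated vertex meets only itself and is treated separately. The closed neighbourhoods of
the other vertices are written one after the other into an array of `O(|E|)` records, and the
algorithm compares *all pairs* of records `(p, q)`; computing in registers is free, only misses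
count. The pairs are visited in the Morton order, whose time `t` interleaves the binary digits of
`p` and `q`.

*Misses.* For each `l` the Morton order runs through the aligned squares of side `2 ^ l` one by one
(`evenBits_div_pow`). With `2 ^ l` proportional to `M`, the records of one square fit into the
cache, so that it costs at most `M / B` misses, and there are `O(|E|² / M²)` squares: this gives
the term `|E|² / (M B)` (`morton_cost`). Copying the lists and writing the output are interleavings
of boundedly many monotone streams of addresses, which cost `O((|V| + |E|) / B + 1)`
(`Scan.exists_cost`). There is no sorting, and `|E| / B` is at most `|E| lg |E| / B + 1`.

*Counting without repetition.* Two lists may meet in many pairs of records, but must be counted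
once, and there is no room for a table of pairs of vertices. Here the alignment helps: each list
lies in a block whose width is a power of two and which starts at a multiple of this width. If the
block of `i` is at least as wide as that of `k`, then all pairs of records of `i` and `k` lie in
one aligned square, in which all rows belong to `i`; so between two visits to the pair of lists
`(i, k)`, no list other than `i` is paired as a row with `k` (`row_eq_of_between`,
`col_eq_of_between`). Hence it suffices that each list remembers the last list with which it was
counted as a column, and the last one with which it was counted as a row (`JoinMem.found_iff`).

Rounding the start of a block up to a multiple of its width does not waste space: a list of `d > 0`
neighbours that is preceded by `o` entries starts beyond `4 * o` and ends before `4 * (o + d)`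
(`st_add_wid_le`).
-/

namespace CacheOblivious

/-! ### Counting cache misses -/

/-- Whatever the cache holds at the start, the accesses `t` can be served with at most `q` misses.
-/
def Cost (M B : ℕ) (t : List ℕ) (q : ℕ) : Prop :=
  ∀ S, ∃ q' ≤ q, Serves M B S t q'

theorem Cost.mono {M B q q' : ℕ} {t : List ℕ} (h : Cost M B t q) (hq : q ≤ q') :
    Cost M B t q' := fun S =>
  let ⟨r, hr, hs⟩ := h S
  ⟨r, hr.trans hq, hs⟩

theorem Cost.append {M B q₁ q₂ : ℕ} {t₁ t₂ : List ℕ} (h₁ : Cost M B t₁ q₁) (h₂ : Cost M B t₂ q₂) :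
    Cost M B (t₁ ++ t₂) (q₁ + q₂) := by
  intro S
  obtain ⟨r, hr, hs⟩ := h₁ S
  suffices h : ∃ q' ≤ r + q₂, Serves M B S (t₁ ++ t₂) q' by
    obtain ⟨q', hq', h⟩ := h
    exact ⟨q', by omega, h⟩
  clear hr h₁
  induction hs with
  | nil S =>
    obtain ⟨q', hq', h⟩ := h₂ S
    exact ⟨q', by omega, h⟩
  | hit ha _ ih =>
    obtain ⟨q', hq', h⟩ := ih
    exact ⟨q', hq', .hit ha h⟩
  | miss ha ha' hS hM _ ih =>
    obtain ⟨q', hq', h⟩ := ih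
    exact ⟨q' + 1, by omega, .miss ha ha' hS hM h⟩

/-- Accesses to a set of lines that fits into the cache cost at most one miss per line. -/
theorem cost_of_lines {M B : ℕ} {t : List ℕ} (L : Finset ℕ) (hL : L.card * B ≤ M)
    (ht : ∀ a ∈ t, a / B ∈ L) : Cost M B t L.card := by
  suffices h : ∀ S, ∃ q' ≤ (L \ S).card, Serves M B S t q' by
    intro S
    obtain ⟨q', hq', h⟩ := h S
    exact ⟨q', hq'.trans (Finset.card_le_card Finset.sdiff_subset), h⟩
  induction t with
  | nil => exact fun S => ⟨0, Nat.zero_le _, .nil S⟩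
  | cons a t ih =>
    intro S
    have haL := ht a (by simp)
    have ih := ih fun b hb => ht b (by simp [hb])
    by_cases ha : a / B ∈ S
    · obtain ⟨q', hq', h⟩ := ih S
      exact ⟨q', hq', .hit ha h⟩
    · obtain ⟨q', hq', h⟩ := ih (insert (a / B) (S ∩ L))
      have hsub : insert (a / B) (S ∩ L) ⊆ L :=
        Finset.insert_subset haL Finset.inter_subset_right
      refine ⟨q' + 1, ?_, .miss ha (Finset.mem_insert_self _ _)
        (Finset.insert_subset_insert _ Finset.inter_subset_left)
        ((Nat.mul_le_mul_right _ (Finset.card_le_card hsub)).trans hL) h⟩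
      have hlt : (L \ insert (a / B) (S ∩ L)).card < (L \ S).card := by
        apply Finset.card_lt_card
        rw [Finset.ssubset_iff]
        refine ⟨a / B, by simp, ?_⟩
        intro x hx
        simp only [Finset.mem_insert, Finset.mem_sdiff, Finset.mem_inter, not_or, not_and] at hx ⊢
        rcases hx with rfl | ⟨hx, -, hx'⟩
        · exact ⟨haL, ha⟩
        · exact ⟨hx, fun h => hx' h hx⟩
      omega

/-- The lines that meet the interval of words from `x` to `x + len`, both included. -/
def linesOf (B x len : ℕ) : Finset ℕ := Finset.Icc (x / B) ((x + len) / B)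

theorem mem_linesOf {B x len a : ℕ} (h₁ : x ≤ a) (h₂ : a ≤ x + len) : a / B ∈ linesOf B x len :=
  Finset.mem_Icc.2 ⟨Nat.div_le_div_right h₁, Nat.div_le_div_right h₂⟩

theorem card_linesOf_mul_le {B : ℕ} (hB : 1 ≤ B) (x len : ℕ) :
    (linesOf B x len).card * B ≤ len + 2 * B := by
  rw [linesOf, Nat.card_Icc]
  have h₁ := Nat.div_mul_le_self (x + len) B
  have h₂ := Nat.lt_div_mul_add (a := x) (b := B) hB
  have h₃ : x / B ≤ (x + len) / B := Nat.div_le_div_right (by omega)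
  obtain ⟨k, hk⟩ := Nat.exists_eq_add_of_le h₃
  rw [hk] at h₁ ⊢
  have : x / B + k + 1 - x / B = k + 1 := by omega
  rw [this]
  linarith [Nat.add_mul (x / B) k B, Nat.add_mul k 1 B]

/-- `Scan v t v'`: the accesses `t` are an interleaving of `r` streams of nondecreasing addresses,
where stream `i` runs from `v i` to at most `v' i`. -/
inductive Scan {r : ℕ} : (Fin r → ℕ) → List ℕ → (Fin r → ℕ) → Prop
  | nil {v v' : Fin r → ℕ} (h : v ≤ v') : Scan v [] v'
  | cons {v v' : Fin r → ℕ} {a : ℕ} {t : List ℕ} (i : Fin r) (hi : v i ≤ a)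
      (h : Scan (Function.update v i a) t v') : Scan v (a :: t) v'

theorem Scan.le {r : ℕ} {v v' : Fin r → ℕ} {t : List ℕ} (h : Scan v t v') : v ≤ v' := by
  induction h with
  | nil h => exact h
  | cons i hi _ ih =>
    refine le_trans ?_ ih
    intro j
    by_cases hj : j = i
    · subst hj; simpa using hi
    · simp [hj]

theorem Scan.append {r : ℕ} {v₁ v₂ v₃ : Fin r → ℕ} {t₁ t₂ : List ℕ} (h₁ : Scan v₁ t₁ v₂)
    (h₂ : Scan v₂ t₂ v₃) : Scan v₁ (t₁ ++ t₂) v₃ := by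
  induction h₁ with
  | @nil v v' h =>
    rw [List.nil_append]
    clear * - h h₂
    induction h₂ generalizing v with
    | nil h' => exact .nil (h.trans h')
    | @cons v' _ a _ i hi _ ih =>
      refine .cons i ((h i).trans hi) (ih ?_)
      intro j
      by_cases hj : j = i
      · subst hj; simp
      · simpa [hj] using h j
  | cons i hi _ ih => exact .cons i hi (ih h₂)

/-- A form of `Scan.cons` in which the next positions of the streams are given explicitly. -/
theorem Scan.cons' {r : ℕ} {v v' : Fin r → ℕ} {t : List ℕ} {a : ℕ} (i : Fin r) (w : Fin r → ℕ)
    (hw : v ≤ w) (hi : v i ≤ a) (ha : a ≤ w i) (h : Scan w t v') : Scan v (a :: t) v' := by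
  refine .cons i hi (Scan.append (t₁ := []) (.nil fun j => ?_) h)
  by_cases hj : j = i
  · subst hj; simpa using ha
  · simpa [hj] using hw j

theorem vec3_le {a b c a' b' c' : ℕ} : ![a, b, c] ≤ ![a', b', c'] ↔ a ≤ a' ∧ b ≤ b' ∧ c ≤ c' := by
  simp [Pi.le_def, Fin.forall_fin_succ]

theorem vec4_le {a b c e a' b' c' e' : ℕ} :
    ![a, b, c, e] ≤ ![a', b', c', e'] ↔ a ≤ a' ∧ b ≤ b' ∧ c ≤ c' ∧ e ≤ e' := by
  simp [Pi.le_def, Fin.forall_fin_succ]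

/-- With one cache line reserved for each stream, a stream costs one miss per line that it runs
through. -/
theorem Scan.exists_cost {r M B : ℕ} {v v' : Fin r → ℕ} {t : List ℕ} (h : Scan v t v')
    (hB : 1 ≤ B) (hM : r * B ≤ M) :
    ∃ q, Cost M B t q ∧ q * B + ∑ i, v i ≤ ∑ i, v' i + 2 * r * B := by
  -- The streams in `V` have their current line in the cache.
  have key : ∀ (V : Finset (Fin r)) (S : Finset ℕ), (∀ i ∈ V, v i / B ∈ S) →
      ∃ q, q + ∑ i, v i / B ≤ ∑ i, v' i / B + Vᶜ.card ∧ Serves M B S t q := by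
    induction h with
    | nil h =>
      intro V S _
      refine ⟨0, ?_, .nil S⟩
      have := Finset.sum_le_sum fun i (_ : i ∈ Finset.univ) => Nat.div_le_div_right (c := B) (h i)
      omega
    | @cons v v' a t i hi _ ih =>
      intro V S hS
      have hsum : ∑ j, Function.update v i a j / B =
          a / B + ∑ j ∈ Finset.univ.erase i, v j / B := by
        rw [← Finset.add_sum_erase _ _ (Finset.mem_univ i)]
        congr 1
        · simp
        · refine Finset.sum_congr rfl fun j hj => ?_
          simp [Finset.ne_of_mem_erase hj]
      have hsum' := Finset.add_sum_erase Finset.univ (fun j => v j / B) (Finset.mem_univ i)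
      have hle : v i / B ≤ a / B := Nat.div_le_div_right hi
      have hcompl : (insert i V)ᶜ.card ≤ Vᶜ.card :=
        Finset.card_le_card (Finset.compl_subset_compl.2 (Finset.subset_insert i V))
      by_cases ha : a / B ∈ S
      · obtain ⟨q, hq, hs⟩ := ih (insert i V) S (by
          intro j hj
          by_cases hji : j = i
          · subst hji; simpa using ha
          · simpa [hji] using hS j (Finset.mem_of_mem_insert_of_ne hj hji))
        exact ⟨q, by omega, .hit ha hs⟩
      · have hmem : a / B ∈ (insert i V).image fun j => Function.update v i a j / B :=
          Finset.mem_image.2 ⟨i, by simp, by simp⟩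
        obtain ⟨q, hq, hs⟩ := ih (insert i V)
          ((insert i V).image fun j => Function.update v i a j / B)
          fun j hj => Finset.mem_image.2 ⟨j, hj, rfl⟩
        refine ⟨q + 1, ?_, .miss ha hmem ?_ ?_ hs⟩
        · by_cases hiV : i ∈ V
          · have : v i / B ≠ a / B := fun h => ha (h ▸ hS i hiV)
            omega
          · have : (insert i V)ᶜ.card < Vᶜ.card := by
              apply Finset.card_lt_card
              rw [Finset.ssubset_iff]
              refine ⟨i, by simp, ?_⟩
              intro j
              simp only [Finset.mem_insert, Finset.mem_compl]
              rintro (rfl | h)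
              · exact hiV
              · exact fun h' => h (Or.inr h')
            omega
        · intro x hx
          obtain ⟨j, hj, rfl⟩ := Finset.mem_image.1 hx
          by_cases hji : j = i
          · subst hji; simp
          · simpa [hji] using Or.inr (hS j (Finset.mem_of_mem_insert_of_ne hj hji))
        · refine (Nat.mul_le_mul_right B ?_).trans hM
          exact (Finset.card_image_le.trans (Finset.card_le_univ _)).trans (by simp)
  have hlo : ∑ i, v i ≤ (∑ i, v i / B) * B + r * B := by
    rw [Finset.sum_mul]
    calc ∑ i, v i ≤ ∑ i : Fin r, (v i / B * B + B) :=
          Finset.sum_le_sum fun i _ => (Nat.lt_div_mul_add hB).le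
      _ = _ := by simp [Finset.sum_add_distrib]
  have hhi : (∑ i, v' i / B) * B ≤ ∑ i, v' i := by
    rw [Finset.sum_mul]
    exact Finset.sum_le_sum fun i _ => Nat.div_mul_le_self _ _
  have hdiv : ∑ i, v i / B ≤ ∑ i, v' i / B :=
    Finset.sum_le_sum fun i _ => Nat.div_le_div_right (h.le i)
  refine ⟨∑ i, v' i / B - ∑ i, v i / B + r, ?_, ?_⟩
  · intro S
    obtain ⟨q, hq, hs⟩ := key ∅ S (by simp)
    refine ⟨q, ?_, hs⟩
    simp only [Finset.compl_empty, Finset.card_univ, Fintype.card_fin] at hq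
    omega
  · obtain ⟨k, hk⟩ := Nat.exists_eq_add_of_le hdiv
    rw [hk] at hhi ⊢
    rw [Nat.add_sub_cancel_left]
    nlinarith

/-- `Pieced A u t`: the accesses `t` are made in `u` rounds, those of round `x` at addresses
in `A x`. -/
inductive Pieced (A : ℕ → Set ℕ) : ℕ → List ℕ → Prop
  | zero : Pieced A 0 []
  | succ {u : ℕ} {t t' : List ℕ} (h : Pieced A u t) (h' : ∀ a ∈ t', a ∈ A u) :
      Pieced A (u + 1) (t ++ t')

/-- The accesses of the last `v` rounds. -/
theorem Pieced.split {A : ℕ → Set ℕ} {u v : ℕ} {t : List ℕ} (h : Pieced A (u + v) t) :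
    ∃ t₁ t₂, t = t₁ ++ t₂ ∧ Pieced A u t₁ ∧ ∀ a ∈ t₂, ∃ x, u ≤ x ∧ x < u + v ∧ a ∈ A x := by
  induction v generalizing t with
  | zero => exact ⟨t, [], by simp, h, by simp⟩
  | succ v ih =>
    rw [← Nat.add_assoc] at h
    cases h with
    | @succ _ t t' h h' =>
      obtain ⟨t₁, t₂, rfl, h₁, h₂⟩ := ih h
      refine ⟨t₁, t₂ ++ t', by simp, h₁, ?_⟩
      intro a ha
      rcases List.mem_append.1 ha with ha | ha
      · obtain ⟨x, hx, hx', hA⟩ := h₂ a ha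
        exact ⟨x, hx, by omega, hA⟩
      · exact ⟨u + v, by omega, by omega, h' a ha⟩

/-- If each group of `g` consecutive rounds stays within few enough lines, then the groups can be
served one by one. -/
theorem Pieced.cost {A : ℕ → Set ℕ} {M B g c : ℕ}
    (hA : ∀ j, ∃ L : Finset ℕ, L.card * B ≤ M ∧ L.card ≤ c ∧
      ∀ x, x / g = j → ∀ a ∈ A x, a / B ∈ L)
    {k : ℕ} {t : List ℕ} (h : Pieced A (g * k) t) : Cost M B t (k * c) := by
  induction k generalizing t with
  | zero =>
    rw [Nat.mul_zero] at h
    cases h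
    exact fun S => ⟨0, by simp, .nil S⟩
  | succ k ih =>
    rw [Nat.mul_succ] at h
    obtain ⟨t₁, t₂, rfl, h₁, h₂⟩ := h.split
    obtain ⟨L, hL, hc, hLA⟩ := hA k
    rw [Nat.succ_mul]
    refine (ih h₁).append ((cost_of_lines L hL ?_).mono hc)
    intro a ha
    obtain ⟨x, hx, hx', hxA⟩ := h₂ a ha
    refine hLA x ?_ a hxA
    refine Nat.div_eq_of_lt_le ?_ ?_
    · rw [Nat.mul_comm]; exact hx
    · rw [Nat.mul_comm, Nat.mul_succ]; exact hx'

/-! ### Weakest preconditions -/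

/-- A precondition under which the program halts, with accesses `t` and in a state `s'`
satisfying `Q t s'`. -/
def wp (W : ℕ) : Prog → (List ℕ → State → Prop) → State → Prop
  | .skip, Q, s => Q [] s
  | .const r v, Q, s => v < W ∧ Q [] (s.setReg r v)
  | .op f r a b, Q, s =>
    f.eval (s.reg a) (s.reg b) < W ∧ Q [] (s.setReg r (f.eval (s.reg a) (s.reg b)))
  | .load r a, Q, s => Q [s.reg a] (s.setReg r (s.mem (s.reg a)))
  | .store a b, Q, s => Q [s.reg a] (s.setMem (s.reg a) (s.reg b))
  | .seq p q, Q, s => wp W p (fun t₁ s₁ => wp W q (fun t₂ s₂ => Q (t₁ ++ t₂) s₂) s₁) s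
  | .ite r p q, Q, s => (s.reg r ≠ 0 → wp W p Q s) ∧ (s.reg r = 0 → wp W q Q s)
  | .loop r p, Q, s => ∃ t s', Exec W (.loop r p) s t s' ∧ Q t s'

theorem wp.exists_exec {W : ℕ} {p : Prog} {Q : List ℕ → State → Prop} {s : State}
    (h : wp W p Q s) : ∃ t s', Exec W p s t s' ∧ Q t s' := by
  induction p generalizing Q s with
  | skip => exact ⟨_, _, .skip s, h⟩
  | const r v => exact ⟨_, _, .const s r v h.1, h.2⟩
  | op f r a b => exact ⟨_, _, .op s f r a b h.1, h.2⟩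
  | load r a => exact ⟨_, _, .load s r a, h⟩
  | store a b => exact ⟨_, _, .store s a b, h⟩
  | seq p q ihp ihq =>
    obtain ⟨t₁, s₁, h₁, h⟩ := ihp h
    obtain ⟨t₂, s₂, h₂, h⟩ := ihq h
    exact ⟨_, _, .seq h₁ h₂, h⟩
  | ite r p q ihp ihq =>
    by_cases hr : s.reg r = 0
    · obtain ⟨t, s', h', h⟩ := ihq (h.2 hr)
      exact ⟨_, _, .iteFalse hr h', h⟩
    · obtain ⟨t, s', h', h⟩ := ihp (h.1 hr)
      exact ⟨_, _, .iteTrue hr h', h⟩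
  | loop r p => exact h

theorem wp.mono {W : ℕ} {p : Prog} {Q Q' : List ℕ → State → Prop} {s : State} (h : wp W p Q s)
    (hQ : ∀ t s', Q t s' → Q' t s') : wp W p Q' s := by
  induction p generalizing Q Q' s with
  | skip | load | store => exact hQ _ _ h
  | const | op => exact ⟨h.1, hQ _ _ h.2⟩
  | seq p q ihp ihq => exact ihp h fun _ _ h => ihq h fun _ _ h => hQ _ _ h
  | ite r p q ihp ihq => exact ⟨fun hr => ihp (h.1 hr) hQ, fun hr => ihq (h.2 hr) hQ⟩
  | loop r p =>
    obtain ⟨t, s', h, hq⟩ := h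
    exact ⟨t, s', h, hQ _ _ hq⟩

/-- The rule for loops: the invariant `I k t s` speaks of the accesses `t` made so far, and
the variant `k` decreases. -/
theorem wp_loop {W r : ℕ} {p : Prog} {Q : List ℕ → State → Prop} (I : ℕ → List ℕ → State → Prop)
    (hstep : ∀ k t s, I k t s → s.reg r ≠ 0 → wp W p (fun t' s' => ∃ k' < k, I k' (t ++ t') s') s)
    (hdone : ∀ k t s, I k t s → s.reg r = 0 → Q t s)
    {k : ℕ} {s : State} (h : I k [] s) : wp W (.loop r p) Q s := by
  suffices H : ∀ k t s, I k t s → ∃ t' s', Exec W (.loop r p) s t' s' ∧ Q (t ++ t') s' from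
    H k [] s h
  intro k
  induction k using Nat.strong_induction_on with
  | _ k ih =>
    intro t s hI
    by_cases hr : s.reg r = 0
    · exact ⟨[], s, .loopDone hr, by simpa using hdone k t s hI hr⟩
    · obtain ⟨t₁, s₁, h₁, k', hk', hI'⟩ := (hstep k t s hI hr).exists_exec
      obtain ⟨t₂, s₂, h₂, hQ⟩ := ih k' hk' _ _ hI'
      exact ⟨_, _, .loopStep hr h₁ h₂, by simpa using hQ⟩

/-- The rule for loops that count up to `N`. -/
theorem wp_loop_range {W r : ℕ} {p : Prog} {Q : List ℕ → State → Prop} (N : ℕ)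
    (I : ℕ → List ℕ → State → Prop)
    (hreg : ∀ i t s, i ≤ N → I i t s → (s.reg r ≠ 0 ↔ i < N))
    (hstep : ∀ i t s, i < N → I i t s → wp W p (fun t' s' => I (i + 1) (t ++ t') s') s)
    (hdone : ∀ t s, I N t s → Q t s)
    {s : State} (h : I 0 [] s) : wp W (.loop r p) Q s := by
  refine wp_loop (k := N) (fun k t s => k ≤ N ∧ I (N - k) t s) ?_ ?_ ⟨le_rfl, by simpa using h⟩
  · rintro k t s ⟨hk, hI⟩ hr
    have hlt := (hreg _ _ _ (Nat.sub_le _ _) hI).1 hr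
    refine (hstep _ _ _ hlt hI).mono fun t' s' h' => ⟨k - 1, by omega, by omega, ?_⟩
    have : N - (k - 1) = N - k + 1 := by omega
    rwa [this]
  · rintro k t s ⟨hk, hI⟩ hr
    have hlt := (hreg _ _ _ (Nat.sub_le _ _) hI).not.1 (by simpa using hr)
    have : N - k = N := by omega
    exact hdone t s (this ▸ hI)

/-- Sequential composition of a list of programs. -/
def block : List Prog → Prog
  | [] => .skip
  | p :: l => .seq p (block l)

@[simp] theorem wp_block_nil {W : ℕ} {Q : List ℕ → State → Prop} {s : State} :
    wp W (block []) Q s = Q [] s := rfl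

@[simp] theorem wp_block_cons {W : ℕ} {p : Prog} {l : List Prog}
    {Q : List ℕ → State → Prop} {s : State} :
    wp W (block (p :: l)) Q s =
      wp W p (fun t₁ s₁ => wp W (block l) (fun t₂ s₂ => Q (t₁ ++ t₂) s₂) s₁) s := rfl

@[simp] theorem wp_const {W r v : ℕ} {Q : List ℕ → State → Prop} {s : State} :
    wp W (.const r v) Q s = (v < W ∧ Q [] (s.setReg r v)) := rfl

@[simp] theorem wp_op {W r a b : ℕ} {f : BinOp} {Q : List ℕ → State → Prop} {s : State} :
    wp W (.op f r a b) Q s =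
      (f.eval (s.reg a) (s.reg b) < W ∧ Q [] (s.setReg r (f.eval (s.reg a) (s.reg b)))) := rfl

@[simp] theorem wp_load {W r a : ℕ} {Q : List ℕ → State → Prop} {s : State} :
    wp W (.load r a) Q s = Q [s.reg a] (s.setReg r (s.mem (s.reg a))) := rfl

@[simp] theorem wp_store {W a b : ℕ} {Q : List ℕ → State → Prop} {s : State} :
    wp W (.store a b) Q s = Q [s.reg a] (s.setMem (s.reg a) (s.reg b)) := rfl

@[simp] theorem wp_seq {W : ℕ} {p q : Prog} {Q : List ℕ → State → Prop} {s : State} :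
    wp W (.seq p q) Q s = wp W p (fun t₁ s₁ => wp W q (fun t₂ s₂ => Q (t₁ ++ t₂) s₂) s₁) s := rfl

@[simp] theorem wp_ite {W r : ℕ} {p q : Prog} {Q : List ℕ → State → Prop} {s : State} :
    wp W (.ite r p q) Q s = ((s.reg r ≠ 0 → wp W p Q s) ∧ (s.reg r = 0 → wp W q Q s)) := rfl

@[simp] theorem State.reg_setReg_self (s : State) (r v : ℕ) : (s.setReg r v).reg r = v := by
  simp [State.setReg]

@[simp] theorem State.reg_setReg_of_ne (s : State) {r x : ℕ} (v : ℕ) (h : x ≠ r) :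
    (s.setReg r v).reg x = s.reg x := by
  simp [State.setReg, h]

@[simp] theorem State.mem_setReg (s : State) (r v : ℕ) : (s.setReg r v).mem = s.mem := rfl

@[simp] theorem State.reg_setMem (s : State) (a v : ℕ) : (s.setMem a v).reg = s.reg := rfl

@[simp] theorem State.mem_setMem (s : State) (a v : ℕ) :
    (s.setMem a v).mem = Function.update s.mem a v := rfl

attribute [simp] BinOp.eval

/-! ### The Morton order -/

/-- The number formed by the binary digits of `t` at the even places. The Morton order visits the
pair `(evenBits t, evenBits (t / 2))` at time `t`. -/
def evenBits (t : ℕ) : ℕ := if t = 0 then 0 else 2 * evenBits (t / 4) + t % 2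
termination_by t
decreasing_by omega

theorem evenBits_zero : evenBits 0 = 0 := by rw [evenBits]; simp

theorem evenBits_eq (t : ℕ) : evenBits t = 2 * evenBits (t / 4) + t % 2 := by
  by_cases h : t = 0
  · subst h; simp [evenBits_zero]
  · conv_lhs => rw [evenBits]
    simp [h]

theorem evenBits_div_pow (t l : ℕ) : evenBits t / 2 ^ l = evenBits (t / 4 ^ l) := by
  induction l with
  | zero => simp
  | succ l ih =>
    rw [pow_succ, pow_succ, ← Nat.div_div_eq_div_mul, ← Nat.div_div_eq_div_mul, ih, evenBits_eq]
    omega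

theorem evenBits_half_div_pow (t l : ℕ) : evenBits (t / 2) / 2 ^ l = evenBits (t / 4 ^ l / 2) := by
  rw [evenBits_div_pow, Nat.div_div_eq_div_mul, Nat.div_div_eq_div_mul, Nat.mul_comm]

theorem evenBits_lt {t l : ℕ} (h : t < 4 ^ l) : evenBits t < 2 ^ l := by
  rw [← Nat.div_eq_zero_iff_lt (by positivity), evenBits_div_pow, Nat.div_eq_of_lt h, evenBits_zero]

/-- The Morton order visits no pair twice. -/
theorem evenBits_injective {t u : ℕ} (h : evenBits t = evenBits u)
    (h' : evenBits (t / 2) = evenBits (u / 2)) : t = u := by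
  induction t using Nat.strong_induction_on generalizing u with
  | _ t ih =>
    have h₁ := evenBits_eq t
    have h₂ := evenBits_eq u
    have h₃ := evenBits_eq (t / 2)
    have h₄ := evenBits_eq (u / 2)
    have e₁ : t / 2 / 4 = t / 4 / 2 := by omega
    have e₂ : u / 2 / 4 = u / 4 / 2 := by omega
    rw [e₁] at h₃
    rw [e₂] at h₄
    by_cases ht : t = 0
    · subst ht
      by_contra hu
      -- the leading digit of `u` would show up in one of the two projections
      have key : ∀ v, v ≠ 0 → evenBits v ≠ 0 ∨ evenBits (v / 2) ≠ 0 := by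
        intro v
        induction v using Nat.strong_induction_on with
        | _ v ihv =>
          intro hv
          have h₁ := evenBits_eq v
          have h₃ := evenBits_eq (v / 2)
          have e₁ : v / 2 / 4 = v / 4 / 2 := by omega
          rw [e₁] at h₃
          by_cases hv4 : v / 4 = 0
          · omega
          · have := ihv (v / 4) (by omega) hv4
            omega
      have := key u (by omega)
      simp only [Nat.zero_div, evenBits_zero] at h h'
      omega
    · have := ih (t / 4) (by omega) (u := u / 4) (by omega) (by omega)
      omega

/-- By time `4 ^ L` the Morton order has visited the whole square of side `2 ^ L`. -/
theorem exists_evenBits {L p q : ℕ} (hp : p < 2 ^ L) (hq : q < 2 ^ L) :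
    ∃ t < 4 ^ L, evenBits t = p ∧ evenBits (t / 2) = q := by
  induction L generalizing p q with
  | zero =>
    refine ⟨0, by simp, ?_, ?_⟩ <;> simp [evenBits_zero] <;> simp at hp hq <;> omega
  | succ L ih =>
    rw [pow_succ] at hp hq
    obtain ⟨t, ht, h₁, h₂⟩ := ih (p := p / 2) (q := q / 2) (by omega) (by omega)
    refine ⟨4 * t + 2 * (q % 2) + p % 2, by rw [pow_succ]; omega, ?_, ?_⟩
    · rw [evenBits_eq, show (4 * t + 2 * (q % 2) + p % 2) / 4 = t by omega]
      omega
    · rw [evenBits_eq, show (4 * t + 2 * (q % 2) + p % 2) / 2 / 4 = t / 2 by omega]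
      omega

/-! ### Aligned blocks for the adjacency lists -/

/-- The number of entries of the lists before list `i`. -/
def off (d : ℕ → ℕ) (i : ℕ) : ℕ := ∑ j ∈ Finset.range i, d j

/-- The width of the block of list `i`: the least power of two above `d i`, so that there is room
for the vertex itself beside its neighbours. -/
def wid (d : ℕ → ℕ) (i : ℕ) : ℕ := 2 ^ (d i).size

/-- The start of the block of list `i`, the first multiple of its width beyond `4 * off d i`. -/
def st (d : ℕ → ℕ) (i : ℕ) : ℕ := (4 * off d i / wid d i + 1) * wid d i

/-- Position `p` is occupied by list `i`. Isolated vertices have no list. -/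
def Occ (n : ℕ) (d : ℕ → ℕ) (p i : ℕ) : Prop :=
  i < n ∧ d i ≠ 0 ∧ st d i ≤ p ∧ p ≤ st d i + d i

theorem size_pow_le_two_mul {x : ℕ} (h : x ≠ 0) : 2 ^ x.size ≤ 2 * x := by
  have h₀ : 0 < x.size := Nat.size_pos.2 (Nat.pos_of_ne_zero h)
  obtain ⟨k, hk⟩ := Nat.exists_eq_succ_of_ne_zero h₀.ne'
  have h₁ : 2 ^ k ≤ x := Nat.lt_size.1 (by omega)
  rw [hk, pow_succ]
  omega

section Layout

variable {n : ℕ} {d : ℕ → ℕ}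

theorem off_succ (i : ℕ) : off d (i + 1) = off d i + d i := Finset.sum_range_succ _ _

theorem off_mono {i j : ℕ} (h : i ≤ j) : off d i ≤ off d j :=
  Finset.sum_le_sum_of_subset (Finset.range_mono h)

theorem wid_pos (i : ℕ) : 0 < wid d i := by unfold wid; positivity

theorem lt_wid (i : ℕ) : d i < wid d i := Nat.lt_size_self _

theorem wid_le {i : ℕ} (h : d i ≠ 0) : wid d i ≤ 2 * d i := size_pow_le_two_mul h

theorem four_mul_off_lt_st (i : ℕ) : 4 * off d i < st d i := by
  have := Nat.lt_div_mul_add (a := 4 * off d i) (wid_pos (d := d) i)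
  rw [st, Nat.succ_mul (4 * off d i / wid d i)]
  exact this

theorem st_le (i : ℕ) : st d i ≤ 4 * off d i + wid d i := by
  rw [st, Nat.succ_mul (4 * off d i / wid d i)]
  exact Nat.add_le_add_right (Nat.div_mul_le_self _ _) _

/-- List `i` fits between `4 * off d i` and `4 * off d (i + 1)`: its width is at most `2 * d i`, and
rounding up the start loses at most another `2 * d i`. -/
theorem st_add_wid_le {i : ℕ} (h : d i ≠ 0) : st d i + wid d i ≤ 4 * off d (i + 1) := by
  have := st_le (d := d) i
  have := wid_le h
  rw [off_succ]
  omega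

theorem four_mul_off_add_wid_le {i : ℕ} (h : i < n) :
    4 * off d i + wid d i ≤ 4 * off d n + 1 := by
  have h₁ := off_succ (d := d) i
  have h₂ := off_mono (d := d) (show i + 1 ≤ n from h)
  by_cases h₀ : d i = 0
  · have : wid d i = 1 := by simp [wid, h₀]
    omega
  · have := wid_le h₀
    omega

theorem div_wid_eq_iff {i p : ℕ} :
    p / wid d i = st d i / wid d i ↔ st d i ≤ p ∧ p < st d i + wid d i := by
  have hw := wid_pos (d := d) i
  have : st d i / wid d i = 4 * off d i / wid d i + 1 := Nat.mul_div_cancel _ hw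
  rw [this, Nat.div_eq_iff hw, st]
  have : (4 * off d i / wid d i + 1) * wid d i + (wid d i - 1) =
    (4 * off d i / wid d i + 1) * wid d i + wid d i - 1 := by omega
  constructor <;> intro h <;> omega

/-- The blocks of different lists are disjoint. -/
theorem block_unique {i j p : ℕ} (hi : d i ≠ 0) (hj : d j ≠ 0) (hpi : st d i ≤ p)
    (hpi' : p < st d i + wid d i) (hpj : st d j ≤ p) (hpj' : p < st d j + wid d j) : i = j := by
  have h₁ := st_add_wid_le hi
  have h₂ := st_add_wid_le hj
  have h₃ := four_mul_off_lt_st (d := d) i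
  have h₄ := four_mul_off_lt_st (d := d) j
  rcases lt_trichotomy i j with h | h | h
  · have := off_mono (d := d) (show i + 1 ≤ j from h)
    omega
  · exact h
  · have := off_mono (d := d) (show j + 1 ≤ i from h)
    omega

theorem Occ.lt {p i : ℕ} (h : Occ n d p i) : p < st d i + wid d i := by
  have := lt_wid (d := d) i
  have := h.2.2.2
  omega

theorem Occ.div_wid {p i : ℕ} (h : Occ n d p i) : p / wid d i = st d i / wid d i :=
  div_wid_eq_iff.2 ⟨h.2.2.1, h.lt⟩

theorem Occ.unique {p i j : ℕ} (hi : Occ n d p i) (hj : Occ n d p j) : i = j :=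
  block_unique hi.2.1 hj.2.1 hi.2.2.1 hi.lt hj.2.2.1 hj.lt

/-- A dyadic interval that is at most as wide as the block of list `i`, and meets this list, meets
no other list. -/
theorem Occ.unique_of_div {p p' i j l : ℕ} (hi : Occ n d p i) (hj : Occ n d p' j)
    (hl : 2 ^ l ∣ wid d i) (h : p / 2 ^ l = p' / 2 ^ l) : j = i := by
  obtain ⟨c, hc⟩ := hl
  have : p' / wid d i = p / wid d i := by
    rw [hc, ← Nat.div_div_eq_div_mul, ← Nat.div_div_eq_div_mul, h]
  have := div_wid_eq_iff.1 (this.trans hi.div_wid)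
  exact block_unique hj.2.1 hi.2.1 hj.2.2.1 hj.lt this.1 this.2

theorem st_inj {i j : ℕ} (hi : d i ≠ 0) (hj : d j ≠ 0) (h : st d i = st d j) : i = j :=
  block_unique (p := st d i) hi hj le_rfl (by have := wid_pos (d := d) i; omega) h.ge
    (by have := wid_pos (d := d) j; omega)

theorem Occ.start {p i : ℕ} (h : Occ n d p i) : Occ n d (st d i) i :=
  ⟨h.1, h.2.1, le_rfl, Nat.le_add_right _ _⟩

theorem Occ.lt_off {p i : ℕ} (h : Occ n d p i) : p < 4 * off d n := by
  have h₁ := h.lt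
  have h₂ := st_add_wid_le h.2.1
  have h₃ := off_mono (d := d) (show i + 1 ≤ n from h.1)
  omega

theorem wid_dvd {i k : ℕ} (h : wid d k ≤ wid d i) : wid d k ∣ wid d i :=
  pow_dvd_pow _ ((Nat.pow_le_pow_iff_right (by norm_num)).1 h)

/-- Between two visits to the product of lists `i` and `k`, the Morton order does not leave the
row block of `i`, if that block is the wider one. -/
theorem row_eq_of_between {i k i' t₁ t₂ t₃ : ℕ} (hik : wid d k ≤ wid d i)
    (hi₁ : Occ n d (evenBits t₁) i) (hk₁ : Occ n d (evenBits (t₁ / 2)) k)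
    (hi₃ : Occ n d (evenBits t₃) i) (hk₃ : Occ n d (evenBits (t₃ / 2)) k)
    (h₁₂ : t₁ ≤ t₂) (h₂₃ : t₂ ≤ t₃) (hi₂ : Occ n d (evenBits t₂) i') : i' = i := by
  have hk : evenBits (t₁ / 2) / wid d i = evenBits (t₃ / 2) / wid d i := by
    obtain ⟨c, hc⟩ := wid_dvd hik
    rw [hc, ← Nat.div_div_eq_div_mul, ← Nat.div_div_eq_div_mul, hk₁.div_wid, hk₃.div_wid]
  have hi := hi₁.div_wid.trans hi₃.div_wid.symm
  rw [wid, evenBits_half_div_pow, evenBits_half_div_pow] at hk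
  rw [wid, evenBits_div_pow, evenBits_div_pow] at hi
  have h := evenBits_injective hi hk
  have h' : t₁ / 4 ^ (d i).size = t₂ / 4 ^ (d i).size :=
    le_antisymm (Nat.div_le_div_right h₁₂) (h ▸ Nat.div_le_div_right h₂₃)
  refine hi₁.unique_of_div hi₂ (l := (d i).size) dvd_rfl ?_
  rw [evenBits_div_pow, evenBits_div_pow, h']

/-- The same for columns. -/
theorem col_eq_of_between {i k k' t₁ t₂ t₃ : ℕ} (hik : wid d i ≤ wid d k)
    (hi₁ : Occ n d (evenBits t₁) i) (hk₁ : Occ n d (evenBits (t₁ / 2)) k)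
    (hi₃ : Occ n d (evenBits t₃) i) (hk₃ : Occ n d (evenBits (t₃ / 2)) k)
    (h₁₂ : t₁ ≤ t₂) (h₂₃ : t₂ ≤ t₃) (hk₂ : Occ n d (evenBits (t₂ / 2)) k') : k' = k := by
  have hi : evenBits t₁ / wid d k = evenBits t₃ / wid d k := by
    obtain ⟨c, hc⟩ := wid_dvd hik
    rw [hc, ← Nat.div_div_eq_div_mul, ← Nat.div_div_eq_div_mul, hi₁.div_wid, hi₃.div_wid]
  have hk := hk₁.div_wid.trans hk₃.div_wid.symm
  rw [wid, evenBits_half_div_pow, evenBits_half_div_pow] at hk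
  rw [wid, evenBits_div_pow, evenBits_div_pow] at hi
  have h := evenBits_injective hi hk
  have h' : t₁ / 4 ^ (d k).size = t₂ / 4 ^ (d k).size :=
    le_antisymm (Nat.div_le_div_right h₁₂) (h ▸ Nat.div_le_div_right h₂₃)
  refine hk₁.unique_of_div hk₂ (l := (d k).size) dvd_rfl ?_
  rw [evenBits_half_div_pow, evenBits_half_div_pow, h']

/-! ### Cache misses of the Morton order -/

/-- The addresses that may be accessed at time `u`: the records of the row and of the column, and
the first records of the two lists that they belong to. -/
def roundAddrs (n : ℕ) (d : ℕ → ℕ) (base u : ℕ) : Set ℕ :=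
  {a | ∃ p, (∃ x, (x = evenBits u ∨ x = evenBits (u / 2)) ∧
    (p = x ∨ ∃ i, Occ n d x i ∧ p = st d i)) ∧ base + 5 * p ≤ a ∧ a ≤ base + 5 * p + 4}

/-- Only one list can reach into a dyadic interval from outside. -/
theorem exists_head (n : ℕ) (d : ℕ → ℕ) (l b : ℕ) :
    ∃ h, ∀ p i, p / 2 ^ l = b → Occ n d p i → st d i / 2 ^ l = b ∨ st d i = h := by
  by_cases hex : ∃ p i, p / 2 ^ l = b ∧ Occ n d p i ∧ l ≤ (d i).size
  · obtain ⟨p₀, i₀, hp₀, hi₀, hl⟩ := hex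
    refine ⟨st d i₀, fun p i hp hi => ?_⟩
    right
    rw [hi₀.unique_of_div hi (pow_dvd_pow 2 hl) (hp₀.trans hp.symm)]
  · refine ⟨0, fun p i hp hi => ?_⟩
    left
    have hl : (d i).size ≤ l := by
      by_contra h
      exact hex ⟨p, i, hp, hi, by omega⟩
    obtain ⟨c, hc⟩ := pow_dvd_pow 2 hl
    rw [← hp, hc]
    change _ / (wid d i * c) = _ / (wid d i * c)
    rw [← Nat.div_div_eq_div_mul, ← Nat.div_div_eq_div_mul, hi.div_wid]

/-- The lines accessed while the Morton order is in one square of side `2 ^ l`: two intervals of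
records, and at most one first record outside of each. -/
theorem exists_tile_lines (n : ℕ) (d : ℕ → ℕ) (base l j : ℕ) {B : ℕ} (hB : 1 ≤ B) :
    ∃ L : Finset ℕ, L.card * B ≤ 10 * 2 ^ l + 16 * B ∧
      ∀ x, x / 4 ^ l = j → ∀ a ∈ roundAddrs n d base x, a / B ∈ L := by
  obtain ⟨h₁, hh₁⟩ := exists_head n d l (evenBits j)
  obtain ⟨h₂, hh₂⟩ := exists_head n d l (evenBits (j / 2))
  let I : ℕ → Finset ℕ := fun b => linesOf B (base + 5 * (2 ^ l * b)) (5 * 2 ^ l)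
  let H : ℕ → Finset ℕ := fun h => linesOf B (base + 5 * h) 4
  have hI : ∀ b, (I b).card * B ≤ 5 * 2 ^ l + 2 * B := fun b => card_linesOf_mul_le hB _ _
  have hH : ∀ h, (H h).card * B ≤ 4 + 2 * B := fun b => card_linesOf_mul_le hB _ _
  have hmemI : ∀ b p a, p / 2 ^ l = b → base + 5 * p ≤ a → a ≤ base + 5 * p + 4 →
      a / B ∈ I b := by
    intro b p a hb ha ha'
    have h₁ := Nat.mul_div_le p (2 ^ l)
    have h₂ := Nat.lt_mul_div_succ p (b := 2 ^ l) (by positivity)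
    rw [hb] at h₁ h₂
    rw [Nat.mul_succ] at h₂
    exact mem_linesOf (by omega) (by omega)
  refine ⟨(I (evenBits j) ∪ I (evenBits (j / 2))) ∪ (H h₁ ∪ H h₂), ?_, ?_⟩
  · have c₁ := Finset.card_union_le (I (evenBits j) ∪ I (evenBits (j / 2))) (H h₁ ∪ H h₂)
    have c₂ := Finset.card_union_le (I (evenBits j)) (I (evenBits (j / 2)))
    have c₃ := Finset.card_union_le (H h₁) (H h₂)
    have e₁ := hI (evenBits j)
    have e₂ := hI (evenBits (j / 2))
    have e₃ := hH h₁
    have e₄ := hH h₂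
    nlinarith
  · rintro x hx a ⟨p, ⟨y, hy, hp⟩, ha, ha'⟩
    simp only [Finset.mem_union]
    rcases hy with rfl | rfl
    · have hb : evenBits x / 2 ^ l = evenBits j := by rw [evenBits_div_pow, hx]
      rcases hp with rfl | ⟨i, hi, rfl⟩
      · exact Or.inl (Or.inl (hmemI _ _ _ hb ha ha'))
      · rcases hh₁ _ _ hb hi with h | h
        · exact Or.inl (Or.inl (hmemI _ _ _ h ha ha'))
        · rw [h] at ha ha'
          exact Or.inr (Or.inl (mem_linesOf ha ha'))
    · have hb : evenBits (x / 2) / 2 ^ l = evenBits (j / 2) := by rw [evenBits_half_div_pow, hx]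
      rcases hp with rfl | ⟨i, hi, rfl⟩
      · exact Or.inl (Or.inr (hmemI _ _ _ hb ha ha'))
      · rcases hh₂ _ _ hb hi with h | h
        · exact Or.inl (Or.inr (hmemI _ _ _ h ha ha'))
        · rw [h] at ha ha'
          exact Or.inr (Or.inr (mem_linesOf ha ha'))

/-- The Morton order is cache-oblivious: for any cache size it can be cut into squares that just
fit into the cache. -/
theorem morton_cost {n base L M B : ℕ} {d : ℕ → ℕ} {t : List ℕ}
    (h : Pieced (roundAddrs n d base) (4 ^ L) t) (hB : 1 ≤ B) (hM : 32 * B ≤ M) :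
    ∃ q, Cost M B t q ∧ q * B * M ≤ 1600 * 4 ^ L + (10 * 2 ^ L + 16 * B) * M := by
  -- Squares of side `2 ^ l` fill between a quarter and a half of the cache.
  obtain ⟨l, hl, hl'⟩ : ∃ l, 20 * 2 ^ l ≤ M ∧ M < 40 * 2 ^ l := by
    refine ⟨Nat.log 2 (M / 20), ?_, ?_⟩
    · have := Nat.pow_log_le_self 2 (x := M / 20) (by omega)
      omega
    · have := Nat.lt_pow_succ_log_self (b := 2) (by norm_num) (M / 20)
      rw [pow_succ] at this
      omega
  by_cases hlL : l ≤ L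
  · refine ⟨4 ^ (L - l) * (M / B), ?_, ?_⟩
    · refine Pieced.cost (A := roundAddrs n d base) (g := 4 ^ l) ?_
        (by rwa [← pow_add, Nat.add_sub_cancel' hlL])
      intro j
      obtain ⟨T, hT, hTm⟩ := exists_tile_lines n d base l j hB
      exact ⟨T, by omega, (Nat.le_div_iff_mul_le hB).2 (by omega), hTm⟩
    · have h₁ : M / B * B ≤ M := Nat.div_mul_le_self _ _
      have h₂ : M * M ≤ 1600 * 4 ^ l := by
        have : (4 : ℕ) ^ l = 2 ^ l * 2 ^ l := by rw [← mul_pow]; norm_num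
        rw [this]
        nlinarith
      have h₃ : (4 : ℕ) ^ L = 4 ^ (L - l) * 4 ^ l := by rw [← pow_add, Nat.sub_add_cancel hlL]
      calc 4 ^ (L - l) * (M / B) * B * M = 4 ^ (L - l) * ((M / B * B) * M) := by ring
        _ ≤ 4 ^ (L - l) * (M * M) := by gcongr
        _ ≤ 4 ^ (L - l) * (1600 * 4 ^ l) := by gcongr
        _ = 1600 * 4 ^ L := by rw [h₃]; ring
        _ ≤ _ := Nat.le_add_right _ _
  · have hLl : 2 ^ L ≤ 2 ^ l := Nat.pow_le_pow_right (by norm_num) (by omega)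
    refine ⟨1 * ((10 * 2 ^ L + 16 * B) / B), ?_, ?_⟩
    · refine Pieced.cost (A := roundAddrs n d base) (g := 4 ^ L) ?_ (by rwa [Nat.mul_one])
      intro j
      obtain ⟨T, hT, hTm⟩ := exists_tile_lines n d base L j hB
      exact ⟨T, by omega, (Nat.le_div_iff_mul_le hB).2 (by omega), hTm⟩
    · rw [Nat.one_mul]
      exact (Nat.mul_le_mul_right _ (Nat.div_mul_le_self _ _)).trans (Nat.le_add_left _ _)

end Layout

/-! ### The program -/

-- The registers. `rOne`, `rTwo`, `rFour`, `rFive` hold constants, `rN` the number of vertices and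
-- `rBase` the address of the first record. In the loops over the vertices, `rI` is the vertex,
-- `rD` its degree, `rO` the sum of the degrees before it, `rW` the width of its block and `rH` the
-- address of its first record. `rT` and `rTT` are the time of the Morton order and its end, and
-- `(rP, rQ)` is the pair visited. `rBT` and `rBS` are the addresses of the two output arrays, and
-- `rC1` and `rC2` count the vertices of eccentricity at most `1` and `2`. `rX` and `rY` are
-- pointers, `rC` is the condition of the outer loops, and the other registers are auxiliary.
abbrev rOut : ℕ := 0
abbrev rOne : ℕ := 1
abbrev rTwo : ℕ := 2
abbrev rFour : ℕ := 3
abbrev rFive : ℕ := 4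
abbrev rN : ℕ := 5
abbrev rBase : ℕ := 6
abbrev rI : ℕ := 7
abbrev rO : ℕ := 8
abbrev rD : ℕ := 9
abbrev rW : ℕ := 10
abbrev rE : ℕ := 11
abbrev rK : ℕ := 12
abbrev rH : ℕ := 13
abbrev rX : ℕ := 14
abbrev rR : ℕ := 15
abbrev rC : ℕ := 16
abbrev rA : ℕ := 17
abbrev rV : ℕ := 18
abbrev rT : ℕ := 19
abbrev rTT : ℕ := 20
abbrev rP : ℕ := 21
abbrev rQ : ℕ := 22
abbrev rU : ℕ := 23
abbrev rZ : ℕ := 24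
abbrev rY : ℕ := 25
abbrev rG : ℕ := 26
abbrev rF : ℕ := 27
abbrev rBT : ℕ := 28
abbrev rBS : ℕ := 29
abbrev rC1 : ℕ := 30
abbrev rC2 : ℕ := 31

/-- `rW := 2 ^ size (reg src)` -/
def powAbove (src : ℕ) : Prog := block [
  .const rW 1,
  .op .add rE src rOne,
  .op .lt rK rW rE,
  .loop rK (block [
    .op .add rW rW rW,
    .op .lt rK rW rE])]

/-- `rH :=` the address of the first record of a list with `rD` entries that is preceded by `rO`
entries. -/
def headAddr : Prog := block [
  powAbove rD,
  .op .mul rH rFour rO,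
  .op .div rH rH rW,
  .op .add rH rH rOne,
  .op .mul rH rH rW,
  .op .mul rH rFive rH,
  .op .add rH rBase rH]

/-- Read the number `n` of vertices. The records start at `1 + n + n * n`, beyond the input. -/
def setup : Prog := block [
  .const rOne 1,
  .const rTwo 2,
  .const rFour 4,
  .const rFive 5,
  .const rA 0,
  .load rN rA,
  .op .mul rBase rN rN,
  .op .add rBase rN rBase,
  .op .add rBase rOne rBase,
  .const rI 0,
  .const rO 0,
  .op .lt rC rI rN]

/-- Copy a neighbour from the input to the next record. -/
def copyEntry : Prog := block [
  .op .add rA rN rO,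
  .op .add rA rOne rA,
  .op .add rA rA rR,
  .load rV rA,
  .op .add rX rX rFour,
  .store rX rH,
  .op .add rX rX rOne,
  .store rX rV,
  .op .add rR rR rOne,
  .op .lt rC rR rD]

/-- Write the records of vertex `rI`, the first one for the vertex itself. A record has five words:
the address of the first record of its list, the entry, and three words that are used in the first
record of a list only, namely the lists with which it was last counted as a column and as a row,
and the number of lists that it meets. A position that holds no record is recognised by its first
word, zero. -/
def copyList : Prog := block [
  .op .add rA rI rOne,
  .load rD rA,
  headAddr,
  .ite rD (block [
    .store rH rH,
    .op .add rX rH rOne,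
    .store rX rI,
    .const rR 0,
    .op .lt rC rR rD,
    .loop rC copyEntry]) .skip,
  .op .add rO rO rD,
  .op .add rI rI rOne,
  .op .lt rC rI rN]

/-- `(rP, rQ) :=` the pair that the Morton order visits at time `rT`. -/
def decode : Prog := block [
  .const rP 0,
  .const rQ 0,
  .op .add rU rT rP,
  .const rZ 1,
  .loop rU (block [
    .op .mod rK rU rTwo,
    .op .mul rK rK rZ,
    .op .add rP rP rK,
    .op .div rU rU rTwo,
    .op .mod rK rU rTwo,
    .op .mul rK rK rZ,
    .op .add rQ rQ rK,
    .op .div rU rU rTwo,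
    .op .add rZ rZ rZ])]

/-- Compare the records at the positions `rP` and `rQ`. If their lists meet here for the first time,
then count this. -/
def visit : Prog := block [
  .op .mul rX rFive rP,
  .op .add rX rBase rX,
  .op .mul rY rFive rQ,
  .op .add rY rBase rY,
  .load rH rX,
  .load rG rY,
  .ite rH (.ite rG (block [
    .op .add rX rX rOne,
    .load rV rX,
    .op .add rY rY rOne,
    .load rF rY,
    .op .eq rK rV rF,
    .ite rK (block [
      .op .add rX rG rTwo,
      .load rV rX,
      .op .eq rK rV rH,
      .op .add rA rH rTwo,
      .op .add rA rA rOne,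
      .load rV rA,
      .op .eq rF rV rG,
      .op .add rK rK rF,
      .ite rK .skip (block [
        .store rX rH,
        .store rA rG,
        .op .add rA rH rFour,
        .load rV rA,
        .op .add rV rV rOne,
        .store rA rV])]) .skip]) .skip) .skip]

/-- Visit all pairs of records in the Morton order, in a square whose side is a power of two. -/
def join : Prog := block [
  .op .mul rD rFour rO,
  powAbove rD,
  .op .mul rTT rW rW,
  .const rT 0,
  .op .lt rC rT rTT,
  .loop rC (block [
    decode,
    visit,
    .op .add rT rT rOne,
    .op .lt rC rT rTT])]

/-- Write the rows of vertex `rI` in both output arrays, when `rD` is its degree and `rV` the number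
of vertices at distance at most `2`. -/
def writeRow : Prog := block [
  .op .add rE rD rOne,
  .op .sub rF rV rE,
  .op .sub rG rN rV,
  .store rX rOne,
  .op .add rX rX rOne,
  .store rX rE,
  .op .add rX rX rOne,
  .store rX rV,
  .op .add rX rX rOne,
  .store rY rOne,
  .op .add rY rY rOne,
  .store rY rD,
  .op .add rY rY rOne,
  .store rY rF,
  .op .add rY rY rOne,
  .store rY rG,
  .op .add rY rY rOne,
  .op .eq rK rE rN,
  .op .add rC1 rC1 rK,
  .op .eq rK rV rN,
  .op .add rC2 rC2 rK,
  .op .add rO rO rD,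
  .op .add rI rI rOne,
  .op .lt rC rI rN]

/-- Treat vertex `rI` in the last loop. An isolated vertex has no records, and only itself at
distance at most `2`. -/
def outputRow : Prog := block [
  .op .add rA rI rOne,
  .load rD rA,
  headAddr,
  .const rV 1,
  .ite rD (block [
    .op .add rA rH rFour,
    .load rV rA]) .skip,
  writeRow]

/-- Write both output arrays, beyond the records, and count the vertices of eccentricity at most `1`
and `2`. -/
def output : Prog := block [
  .op .mul rBT rFive rW,
  .op .add rBT rBase rBT,
  .op .add rBS rBT rN,
  .op .add rBS rBS rN,
  .op .add rBS rBS rN,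
  .const rI 0,
  .const rO 0,
  .const rC1 0,
  .const rC2 0,
  .op .add rX rBT rO,
  .op .add rY rBS rO,
  .op .lt rC rI rN,
  .loop rC outputRow]

/-- The common part of the four algorithms. -/
def core : Prog := block [
  setup,
  .loop rC copyList,
  join,
  output]

/-! ### Correctness of the program -/

/-- The registers that are constant from `setup` on. -/
structure Consts (n base : ℕ) (s : State) : Prop where
  one : s.reg rOne = 1
  two : s.reg rTwo = 2
  four : s.reg rFour = 4
  five : s.reg rFive = 5
  n : s.reg rN = n
  base : s.reg rBase = base

theorem wp_powAbove {W src : ℕ} {Q : List ℕ → State → Prop} {s : State}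
    (h₁ : src ≠ rW) (hone : s.reg rOne = 1)
    (hW : 2 ^ (s.reg src).size < W) (hW' : s.reg src + 1 < W)
    (hQ : ∀ s' : State, s'.mem = s.mem → s'.reg rW = 2 ^ (s.reg src).size →
      (∀ y, y ≠ rW → y ≠ rE → y ≠ rK → s'.reg y = s.reg y) → Q [] s') :
    wp W (powAbove src) Q s := by
  have hlt : ∀ i, 2 ^ i < s.reg src + 1 ↔ i < (s.reg src).size := fun i => by
    rw [Nat.lt_size, Nat.lt_succ_iff]
  have hite : ∀ p : Prop, ∀ [Decidable p], (if p then 1 else 0) < W := by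
    intro p _; split_ifs <;> omega
  simp (disch := decide) only [powAbove, wp_block_cons, wp_block_nil, wp_const, wp_op,
    State.reg_setReg_self, State.reg_setReg_of_ne, BinOp.eval, hone,
    State.reg_setReg_of_ne _ _ h₁, List.nil_append, List.append_nil, hite, hW', true_and]
  refine ⟨by omega, wp_loop_range (s.reg src).size (fun i t s' => t = [] ∧ s'.mem = s.mem ∧
    s'.reg rW = 2 ^ i ∧ s'.reg rE = s.reg src + 1 ∧
    s'.reg rK = (if 2 ^ i < s.reg src + 1 then 1 else 0) ∧
    ∀ y, y ≠ rW → y ≠ rE → y ≠ rK → s'.reg y = s.reg y) ?_ ?_ ?_ ?_⟩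
  · rintro i t s' - ⟨-, -, -, -, hK, -⟩
    simp [hK, hlt]
  · rintro i t s' hi ⟨rfl, hm, hw, he, -, hf⟩
    have hp : 2 ^ i + 2 ^ i < W := by
      have := Nat.pow_le_pow_right (n := 2) (by norm_num) (show i + 1 ≤ _ from hi)
      rw [pow_succ] at this
      omega
    simp (disch := decide) only [wp_block_cons, wp_block_nil, wp_op,
      State.reg_setReg_self, State.reg_setReg_of_ne, BinOp.eval, hw, he, hite, true_and,
      List.nil_append, State.mem_setReg, hm, ← two_mul, pow_succ']
    refine ⟨by omega, ?_⟩
    intro y h₁ h₂ h₃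
    simp only [h₁, h₂, h₃, State.reg_setReg_of_ne, ne_eq, not_false_eq_true, hf]
  · rintro t s' ⟨rfl, hm, hw, -, -, hf⟩
    exact hQ s' hm hw hf
  · refine ⟨rfl, rfl, ?_, ?_, ?_, ?_⟩
    · simp (disch := decide)
    · simp (disch := decide)
    · simp (disch := decide)
    · intro y h₁ h₂ h₃
      simp only [h₁, h₂, h₃, State.reg_setReg_of_ne, ne_eq, not_false_eq_true]

theorem wp_headAddr {W i n base : ℕ} {d : ℕ → ℕ} {Q : List ℕ → State → Prop} {s : State}
    (hc : Consts n base s) (hd : s.reg rD = d i) (ho : s.reg rO = off d i)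
    (hW : base + 5 * (4 * off d i + wid d i) + 5 < W)
    (hQ : ∀ s' : State, s'.mem = s.mem → s'.reg rH = base + 5 * st d i →
      (∀ y, y ≠ rW → y ≠ rE → y ≠ rK → y ≠ rH → s'.reg y = s.reg y) → Q [] s') :
    wp W headAddr Q s := by
  have h₁ := lt_wid (d := d) i
  rw [headAddr, wp_block_cons]
  refine wp_powAbove (by decide) hc.one ?_ (by omega) ?_
  · rw [hd]; change wid d i < W; omega
  intro s' hm hw hf
  have hst := st_le (d := d) i
  have hdiv := Nat.div_le_self (4 * off d i) (wid d i)
  have hw' : s'.reg rW = wid d i := by rw [hw, hd, wid]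
  have hst' : (4 * off d i / wid d i + 1) * wid d i = st d i := rfl
  simp (disch := decide) only [wp_block_cons, wp_block_nil, wp_op,
    State.reg_setReg_self, State.reg_setReg_of_ne, BinOp.eval, hf, hc.one, hc.four, hc.five,
    hc.base, ho, hw', hst', List.append_nil, List.nil_append]
  refine ⟨by omega, by omega, by omega, by omega, by omega, by omega, ?_⟩
  refine hQ _ (by simpa using hm) (by simp) ?_
  intro y h₁ h₂ h₃ h₄
  simp only [h₁, h₂, h₃, h₄, State.reg_setReg_of_ne, ne_eq, not_false_eq_true, hf]

theorem wp_decode {W n base : ℕ} {Q : List ℕ → State → Prop} {s : State}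
    (hc : Consts n base s) (hW : 2 * s.reg rT + 2 < W)
    (hQ : ∀ s' : State, s'.mem = s.mem → s'.reg rP = evenBits (s.reg rT) →
      s'.reg rQ = evenBits (s.reg rT / 2) →
      (∀ y, y ≠ rP → y ≠ rQ → y ≠ rU → y ≠ rZ → y ≠ rK → s'.reg y = s.reg y) → Q [] s') :
    wp W decode Q s := by
  set T := s.reg rT with hT
  have hle : ∀ t, evenBits t ≤ t := by
    intro t
    induction t using Nat.strong_induction_on with
    | _ t ih =>
      rw [evenBits_eq]
      by_cases ht : t = 0
      · subst ht; simp [evenBits_zero]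
      · have := ih (t / 4) (by omega)
        omega
  simp (disch := decide) only [decode, wp_block_cons, wp_block_nil, wp_op, wp_const,
    State.reg_setReg_self, State.reg_setReg_of_ne, BinOp.eval, ← hT, List.append_nil,
    List.nil_append]
  refine ⟨by omega, by omega, by omega, by omega, ?_⟩
  refine wp_loop (k := T) (fun k t s' => t = [] ∧ s'.mem = s.mem ∧ s'.reg rU = k ∧
    s'.reg rP + s'.reg rZ * evenBits k = evenBits T ∧
    s'.reg rQ + s'.reg rZ * evenBits (k / 2) = evenBits (T / 2) ∧
    s'.reg rZ * k ≤ T ∧ 0 < s'.reg rZ ∧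
    ∀ y, y ≠ rP → y ≠ rQ → y ≠ rU → y ≠ rZ → y ≠ rK → s'.reg y = s.reg y) ?_ ?_ ?_
  · rintro k t s' ⟨rfl, hm, hu, hp, hq, hz, hz', hf⟩ hr
    rw [hu] at hr
    generalize hP : s'.reg rP = a at *
    generalize hB : s'.reg rQ = b at *
    generalize hZ : s'.reg rZ = z at *
    have hzk : z ≤ T := le_trans (Nat.le_mul_of_pos_right _ (Nat.pos_of_ne_zero hr)) hz
    have e₁ := evenBits_eq k
    have e₂ := evenBits_eq (k / 2)
    have e₃ : k / 2 / 4 = k / 4 / 2 := by omega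
    rw [e₃] at e₂
    have b₁ : k % 2 * z ≤ z := by
      have : k % 2 ≤ 1 := by omega
      nlinarith
    have b₂ : k / 2 % 2 * z ≤ z := by
      have : k / 2 % 2 ≤ 1 := by omega
      nlinarith
    have hTP := hle T
    have hTQ := hle (T / 2)
    have p' : a + k % 2 * z + (z + z) * evenBits (k / 4) = evenBits T := by
      rw [← hp, e₁]; ring
    have q' : b + k / 2 % 2 * z + (z + z) * evenBits (k / 4 / 2) = evenBits (T / 2) := by
      rw [← hq, e₂]; ring
    have hkT : k ≤ T := le_trans (Nat.le_mul_of_pos_left _ hz') hz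
    simp (disch := decide) only [wp_block_cons, wp_block_nil, wp_op,
      State.reg_setReg_self, State.reg_setReg_of_ne, BinOp.eval, hu, hP, hB, hZ, hf, hc.two,
      List.append_nil, State.mem_setReg, hm, true_and, List.nil_append]
    refine ⟨by omega, by omega, by omega, by omega, by omega, by omega, by omega, by omega,
      by omega, k / 2 / 2, by omega, rfl, ?_, ?_, ?_, by omega, ?_⟩
    · rw [show k / 2 / 2 = k / 4 by omega, p']
    · rw [show k / 2 / 2 = k / 4 by omega, q']
    · have : 2 * (k / 2 / 2) ≤ k := by omega
      nlinarith
    · intro y h₁ h₂ h₃ h₄ h₅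
      simp only [h₁, h₂, h₃, h₄, h₅, State.reg_setReg_of_ne, ne_eq, not_false_eq_true, hf]
  · rintro k t s' ⟨rfl, hm, hu, hp, hq, -, -, hf⟩ hr
    rw [hr] at hu
    subst hu
    simp only [evenBits_zero, Nat.zero_div, Nat.mul_zero, Nat.add_zero] at hp hq
    exact hQ s' hm hp hq hf
  · simp (disch := decide)
    intro y h₁ h₂ h₃ h₄ h₅
    simp only [h₁, h₂, h₃, h₄, State.reg_setReg_of_ne, ne_eq, not_false_eq_true]

/-- What the program needs to know of its input: `d i` is the length of list `i`, and `cl i` is the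
list of `i` itself followed by its neighbours. All numbers that occur in the run are bounded by the
left side of `word`. -/
structure Input (W n base : ℕ) (d : ℕ → ℕ) (cl : ℕ → ℕ → ℕ) (μ₀ : ℕ → ℕ) : Prop where
  size : μ₀ 0 = n
  deg : ∀ i < n, μ₀ (i + 1) = d i
  self : ∀ i, cl i 0 = i
  entry : ∀ i < n, ∀ r < d i, μ₀ (1 + (n + off d i) + r) = cl i (r + 1)
  base_eq : base = 1 + (n * n + n)
  le_base : 1 + n + off d n ≤ base
  zero : ∀ a, base ≤ a → μ₀ a = 0
  word : base + 10 * 2 ^ (4 * off d n).size + 2 * (2 ^ (4 * off d n).size * 2 ^ (4 * off d n).size)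
    + 10 * n + 100 ≤ W

theorem ite_one_lt {W : ℕ} (hW : 1 < W) (p : Prop) [Decidable p] : (if p then 1 else 0) < W := by
  split_ifs <;> omega

/-- The record of entry `r` of list `j` has been written, when the lists before list `i` and the
entries of list `i` before entry `R` have been. -/
def Written (d : ℕ → ℕ) (i R j r : ℕ) : Prop :=
  (j < i ∨ j = i ∧ r < R) ∧ d j ≠ 0 ∧ r ≤ d j

/-- The contents `μ` of the memory while the lists are copied. -/
structure Filled (base : ℕ) (d : ℕ → ℕ) (cl : ℕ → ℕ → ℕ) (μ₀ : ℕ → ℕ) (i R : ℕ) (μ : ℕ → ℕ) :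
    Prop where
  low : ∀ a < base, μ a = μ₀ a
  head : ∀ j r, Written d i R j r → μ (base + 5 * (st d j + r)) = base + 5 * st d j
  val : ∀ j r, Written d i R j r → μ (base + 5 * (st d j + r) + 1) = cl j r
  zero : ∀ a, base ≤ a → (∀ j r, Written d i R j r →
    a ≠ base + 5 * (st d j + r) ∧ a ≠ base + 5 * (st d j + r) + 1) → μ a = 0

section

variable {W n base : ℕ} {d : ℕ → ℕ} {cl : ℕ → ℕ → ℕ} {μ₀ μ : ℕ → ℕ}

/-- The next record does not overwrite an earlier one, since the blocks are disjoint. -/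
theorem Filled.write {i R : ℕ} (h : Filled base d cl μ₀ i R μ) (hd : d i ≠ 0) (hR : R ≤ d i) :
    Filled base d cl μ₀ i (R + 1)
      (Function.update (Function.update μ (base + 5 * (st d i + R)) (base + 5 * st d i))
        (base + 5 * (st d i + R) + 1) (cl i R)) := by
  have hself : Written d i (R + 1) i R := ⟨Or.inr ⟨rfl, Nat.lt_succ_self R⟩, hd, hR⟩
  have key : ∀ j r, Written d i (R + 1) j r → (j = i ∧ r = R) ∨
      (Written d i R j r ∧ st d j + r ≠ st d i + R) := by
    rintro j r ⟨hj, hdj, hr⟩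
    have h₁ := lt_wid (d := d) i
    have h₂ := lt_wid (d := d) j
    by_cases hji : j = i
    · subst hji
      by_cases hrR : r = R
      · exact Or.inl ⟨rfl, hrR⟩
      · exact Or.inr ⟨⟨Or.inr ⟨rfl, by omega⟩, hdj, hr⟩, by omega⟩
    · refine Or.inr ⟨⟨Or.inl (by omega), hdj, hr⟩, fun he => hji ?_⟩
      exact block_unique (p := st d j + r) hdj hd (by omega) (by omega) (by omega) (by omega)
  have mono : ∀ j r, Written d i R j r → Written d i (R + 1) j r := by
    rintro j r ⟨hj, h⟩
    exact ⟨by omega, h⟩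
  refine ⟨fun a ha => ?_, fun j r hw => ?_, fun j r hw => ?_, fun a ha hw => ?_⟩
  · rw [Function.update_of_ne (by omega), Function.update_of_ne (by omega), h.low a ha]
  · rcases key j r hw with ⟨rfl, rfl⟩ | ⟨hw', hne⟩
    · rw [Function.update_of_ne (by omega), Function.update_self]
    · rw [Function.update_of_ne (by omega), Function.update_of_ne (by omega), h.head j r hw']
  · rcases key j r hw with ⟨rfl, rfl⟩ | ⟨hw', hne⟩
    · rw [Function.update_self]
    · rw [Function.update_of_ne (by omega), Function.update_of_ne (by omega), h.val j r hw']
  · rw [Function.update_of_ne (hw i R hself).2, Function.update_of_ne (hw i R hself).1,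
      h.zero a ha fun j r hw' => hw j r (mono j r hw')]

theorem Filled.congr {i R i' R' : ℕ} (h : Filled base d cl μ₀ i R μ)
    (hw : ∀ j r, Written d i R j r ↔ Written d i' R' j r) : Filled base d cl μ₀ i' R' μ :=
  ⟨h.low, fun j r hj => h.head j r ((hw j r).2 hj), fun j r hj => h.val j r ((hw j r).2 hj),
    fun a ha hj => h.zero a ha fun j r hj' => hj j r ((hw j r).1 hj')⟩

theorem Input.filled (h : Input W n base d cl μ₀) : Filled base d cl μ₀ 0 0 μ₀ :=
  ⟨fun _ _ => rfl, by rintro j r ⟨hj, -⟩; omega, by rintro j r ⟨hj, -⟩; omega,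
    fun a ha _ => h.zero a ha⟩

/-- The invariant of the loop that copies list `i`. -/
structure CopyInv (n base : ℕ) (d : ℕ → ℕ) (cl : ℕ → ℕ → ℕ) (μ₀ : ℕ → ℕ) (i r : ℕ) (t : List ℕ)
    (s : State) : Prop where
  consts : Consts n base s
  reg_i : s.reg rI = i
  reg_o : s.reg rO = off d i
  reg_d : s.reg rD = d i
  reg_h : s.reg rH = base + 5 * st d i
  reg_r : s.reg rR = r
  reg_x : s.reg rX = base + 5 * (st d i + r) + 1
  reg_c : s.reg rC = if r < d i then 1 else 0
  mem : Filled base d cl μ₀ i (r + 1) s.mem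
  scan : Scan ![i + 1, 1 + n + off d i, base + 5 * st d i + 1] t
    ![i + 1, 1 + n + off d i + r, base + 5 * (st d i + r) + 1]

theorem wp_copy_loop {i : ℕ} {Q : List ℕ → State → Prop} {s : State}
    (hin : Input W n base d cl μ₀) (hi : i < n) (hd : d i ≠ 0)
    (h : CopyInv n base d cl μ₀ i 0 [] s)
    (hQ : ∀ t s', CopyInv n base d cl μ₀ i (d i) t s' → Q t s') :
    wp W (.loop rC copyEntry) Q s := by
  refine wp_loop_range (d i) (CopyInv n base d cl μ₀ i) ?_ ?_ hQ h
  · intro r t s' _ h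
    rw [h.reg_c]
    simp
  intro r t s' hr h
  have hc := h.consts
  have hword := hin.word
  have hbase := hin.le_base
  have hoff := off_mono (d := d) (show i + 1 ≤ n from hi)
  rw [off_succ] at hoff
  have hst := st_add_wid_le hd
  have hwid := lt_wid (d := d) i
  have hbig : 4 * off d n < 2 ^ (4 * off d n).size := Nat.lt_size_self _
  rw [off_succ] at hst
  have hmem : s'.mem (1 + (n + off d i) + r) = cl i (r + 1) := by
    rw [h.mem.low _ (by omega), hin.entry i hi r hr]
  have hx : base + 5 * (st d i + r) + 1 + 4 = base + 5 * (st d i + (r + 1)) := by ring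
  simp (disch := decide) only [copyEntry, wp_block_cons, wp_block_nil, wp_op, wp_load, wp_store,
    State.reg_setReg_self, State.reg_setReg_of_ne, State.mem_setReg, State.reg_setMem,
    BinOp.eval, hc.one, hc.four, hc.n, h.reg_o, h.reg_d, h.reg_h, h.reg_r, h.reg_x, hmem,
    ite_one_lt (show 1 < W by omega), List.append_nil, List.nil_append, List.cons_append, true_and,
    hx]
  refine ⟨by omega, by omega, by omega, by omega, by omega, by omega, ?_⟩
  refine ⟨⟨?_, ?_, ?_, ?_, ?_, ?_⟩, ?_, ?_, ?_, ?_, ?_, ?_, ?_, ?_, ?_⟩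
  all_goals try simp (disch := decide) only [State.reg_setReg_self, State.reg_setReg_of_ne,
    State.mem_setReg, State.reg_setMem, State.mem_setMem, hc.one, hc.two, hc.four, hc.five, hc.n,
    hc.base, h.reg_i, h.reg_o, h.reg_d, h.reg_h]
  · exact h.mem.write hd hr
  · refine h.scan.append ?_
    refine .cons' 1 ![i + 1, 1 + n + off d i + (r + 1), base + 5 * (st d i + r) + 1]
      (vec3_le.2 (by omega)) ?_ ?_ ?_
    · simp; omega
    · simp; omega
    refine .cons' 2 ![i + 1, 1 + n + off d i + (r + 1), base + 5 * (st d i + (r + 1))]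
      (vec3_le.2 (by omega)) ?_ ?_ ?_
    · simp
    · simp
    refine .cons' 2 ![i + 1, 1 + n + off d i + (r + 1), base + 5 * (st d i + (r + 1)) + 1]
      (vec3_le.2 (by omega)) ?_ ?_ ?_
    · simp
    · simp
    exact .nil le_rfl

/-- The invariant of the loop that copies all lists. -/
structure FillInv (n base : ℕ) (d : ℕ → ℕ) (cl : ℕ → ℕ → ℕ) (μ₀ : ℕ → ℕ) (i : ℕ) (t : List ℕ)
    (s : State) : Prop where
  consts : Consts n base s
  reg_i : s.reg rI = i
  reg_o : s.reg rO = off d i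
  reg_c : s.reg rC = if i < n then 1 else 0
  mem : Filled base d cl μ₀ i 0 s.mem
  scan : Scan ![1, 1 + n, base] t ![i + 1, 1 + n + off d i, base + 5 * (4 * off d i)]

theorem wp_fill_loop {Q : List ℕ → State → Prop} {s : State} (hin : Input W n base d cl μ₀)
    (h : FillInv n base d cl μ₀ 0 [] s) (hQ : ∀ t s', FillInv n base d cl μ₀ n t s' → Q t s') :
    wp W (.loop rC copyList) Q s := by
  refine wp_loop_range n (FillInv n base d cl μ₀) ?_ ?_ hQ h
  · intro i t s' _ h
    rw [h.reg_c]
    simp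
  intro i t s' hi h
  have hc := h.consts
  have hword := hin.word
  have hbase := hin.le_base
  have hoff := off_mono (d := d) (show i + 1 ≤ n from hi)
  have hoff' := off_succ (d := d) i
  have hwid := lt_wid (d := d) i
  have hwid' := four_mul_off_add_wid_le (d := d) hi
  have hlt := four_mul_off_lt_st (d := d) i
  have hbig : 4 * off d n < 2 ^ (4 * off d n).size := Nat.lt_size_self _
  have hmem : s'.mem (i + 1) = d i := by rw [h.mem.low _ (by omega), hin.deg i hi]
  simp (disch := decide) only [copyList, wp_block_cons, wp_op, wp_load,
    State.reg_setReg_self, State.reg_setReg_of_ne, State.mem_setReg, BinOp.eval, hc.one, h.reg_i,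
    hmem]
  refine ⟨by omega, ?_⟩
  refine wp_headAddr (i := i) (n := n) (base := base) (d := d) ?_ ?_ ?_ (by omega) ?_
  · constructor <;> simp (disch := decide) only [State.reg_setReg_of_ne, hc.one, hc.two, hc.four,
      hc.five, hc.n, hc.base]
  · simp (disch := decide) only [State.reg_setReg_self]
  · simp (disch := decide) only [State.reg_setReg_of_ne, h.reg_o]
  intro s₁ hm₁ hh₁ hf₁
  simp only [State.mem_setReg] at hm₁
  have f₁ : Consts n base s₁ := by
    constructor <;> rw [hf₁ _ (by decide) (by decide) (by decide) (by decide)] <;>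
      simp (disch := decide) only [State.reg_setReg_of_ne, hc.one, hc.two, hc.four,
      hc.five, hc.n, hc.base]
  have f₂ : s₁.reg rI = i := by
    rw [hf₁ _ (by decide) (by decide) (by decide) (by decide)]
    simp (disch := decide) only [State.reg_setReg_of_ne, h.reg_i]
  have f₃ : s₁.reg rO = off d i := by
    rw [hf₁ _ (by decide) (by decide) (by decide) (by decide)]
    simp (disch := decide) only [State.reg_setReg_of_ne, h.reg_o]
  have f₄ : s₁.reg rD = d i := by
    rw [hf₁ _ (by decide) (by decide) (by decide) (by decide)]
    simp (disch := decide) only [State.reg_setReg_self]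
  rw [wp_ite, f₄]
  refine ⟨fun hd => ?_, fun hd => ?_⟩
  · have hst := st_add_wid_le hd
    simp (disch := decide) only [wp_block_cons, wp_op, wp_const, wp_store,
      State.reg_setReg_self, State.reg_setReg_of_ne, State.reg_setMem,
      BinOp.eval, f₁.one, hh₁, f₂, f₄, ite_one_lt (show 1 < W by omega), true_and]
    refine ⟨by omega, by omega, wp_copy_loop hin hi hd ?_ ?_⟩
    · refine ⟨⟨?_, ?_, ?_, ?_, ?_, ?_⟩, ?_, ?_, ?_, ?_, ?_, ?_, ?_, ?_, .nil le_rfl⟩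
      all_goals try simp (disch := decide) only [State.reg_setReg_self, State.reg_setReg_of_ne,
        State.mem_setReg, State.reg_setMem, State.mem_setMem, f₁.one, f₁.two, f₁.four, f₁.five,
        f₁.n, f₁.base, f₂, f₃, f₄, hh₁, hm₁, Nat.add_zero]
      · have := h.mem.write hd (Nat.zero_le _)
        rwa [hin.self, Nat.add_zero] at this
    · intro t' s₂ h₂
      have hc := h₂.consts
      simp (disch := decide) only [wp_block_nil,
        hc.one, hc.n, h₂.reg_i, h₂.reg_o, h₂.reg_d,
        List.append_nil, List.nil_append, List.cons_append]
      refine ⟨by omega, by omega, ?_⟩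
      refine ⟨⟨?_, ?_, ?_, ?_, ?_, ?_⟩, ?_, ?_, ?_, ?_, ?_⟩
      all_goals try simp (disch := decide) only [State.reg_setReg_self, State.reg_setReg_of_ne,
        State.mem_setReg, hc.one, hc.two, hc.four, hc.five, hc.n, hc.base, hoff']
      · refine h₂.mem.congr fun j r => ?_
        unfold Written
        constructor
        · rintro ⟨hj, h⟩; exact ⟨by omega, h⟩
        · rintro ⟨hj, h, hr⟩
          refine ⟨?_, h, hr⟩
          by_cases hji : j = i
          · subst hji; omega
          · omega
      · refine h.scan.append (.cons' 0 ![i + 1, 1 + n + off d i, base + 5 * (4 * off d i)]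
          (vec3_le.2 (by omega)) (by simp) (by simp) ?_)
        refine .cons' 2 ![i + 1, 1 + n + off d i, base + 5 * st d i]
          (vec3_le.2 (by omega)) (by simp; omega) (by simp) ?_
        refine .cons' 2 ![i + 1, 1 + n + off d i, base + 5 * st d i + 1]
          (vec3_le.2 (by omega)) (by simp) (by simp) ?_
        have := h₂.scan.append (t₂ := []) (.nil (v' := ![i + 1 + 1, 1 + n + (off d i + d i),
          base + 5 * (4 * (off d i + d i))]) (vec3_le.2 (by omega)))
        simpa using this
  · simp (disch := decide) only [wp, wp_block_nil,
      f₁.one, f₁.n, f₂, f₃, f₄,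
      ite_one_lt (show 1 < W by omega), List.nil_append, List.cons_append]
    refine ⟨by omega, by omega, trivial, ?_⟩
    refine ⟨⟨?_, ?_, ?_, ?_, ?_, ?_⟩, ?_, ?_, ?_, ?_, ?_⟩
    all_goals try simp (disch := decide) only [State.reg_setReg_self, State.reg_setReg_of_ne,
      State.mem_setReg, f₁.one, f₁.two, f₁.four, f₁.five, f₁.n, f₁.base, hoff', hm₁]
    · refine h.mem.congr fun j r => ?_
      unfold Written
      constructor
      · rintro ⟨hj, h⟩; exact ⟨by omega, h⟩
      · rintro ⟨hj, h, hr⟩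
        refine ⟨?_, h, hr⟩
        by_cases hji : j = i
        · subst hji; omega
        · omega
    · exact h.scan.append (.cons' 0 ![i + 1 + 1, 1 + n + (off d i + d i),
        base + 5 * (4 * (off d i + d i))] (vec3_le.2 (by omega)) (by simp) (by simp) (.nil le_rfl))

end

/-- At time `t` the Morton order visits a common element of the lists `i` and `k`. -/
def Hit (n : ℕ) (d : ℕ → ℕ) (cl : ℕ → ℕ → ℕ) (t i k : ℕ) : Prop :=
  Occ n d (evenBits t) i ∧ Occ n d (evenBits (t / 2)) k ∧
    cl i (evenBits t - st d i) = cl k (evenBits (t / 2) - st d k)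

open Classical in
/-- The lists of which a common element with list `i` has been visited before time `u`. -/
noncomputable def met (n : ℕ) (d : ℕ → ℕ) (cl : ℕ → ℕ → ℕ) (u i : ℕ) : Finset ℕ :=
  (Finset.range n).filter fun k => ∃ t < u, Hit n d cl t i k

/-- The contents `μ` of the memory at time `u` of the Morton order, which started with `μ₁`. Word
`2` of the first record of list `k` is the row list that was last counted together with `k`, word
`3` of the first record of list `i` is the column list that was last counted together with `i`, and
word `4` is the number of lists met. -/
structure JoinMem (n base : ℕ) (d : ℕ → ℕ) (cl : ℕ → ℕ → ℕ) (μ₁ : ℕ → ℕ) (u : ℕ) (μ : ℕ → ℕ) :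
    Prop where
  same : ∀ a, (∀ j, j < n → d j ≠ 0 → a ≠ base + 5 * st d j + 2 ∧ a ≠ base + 5 * st d j + 3 ∧
    a ≠ base + 5 * st d j + 4) → μ a = μ₁ a
  cnt : ∀ i, i < n → d i ≠ 0 → μ (base + 5 * st d i + 4) = (met n d cl u i).card
  row : ∀ i k, d i ≠ 0 → k < n → d k ≠ 0 → μ (base + 5 * st d k + 2) = base + 5 * st d i →
    ∃ t < u, Hit n d cl t i k
  col : ∀ i k, i < n → d i ≠ 0 → d k ≠ 0 → μ (base + 5 * st d i + 3) = base + 5 * st d k →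
    ∃ t < u, Hit n d cl t i k
  row_last : ∀ t < u, ∀ i k, Hit n d cl t i k → wid d k ≤ wid d i →
    μ (base + 5 * st d k + 2) = base + 5 * st d i ∨
      ∃ t' i', t < t' ∧ t' < u ∧ i' ≠ i ∧ Hit n d cl t' i' k
  col_last : ∀ t < u, ∀ i k, Hit n d cl t i k → wid d i ≤ wid d k →
    μ (base + 5 * st d i + 3) = base + 5 * st d k ∨
      ∃ t' k', t < t' ∧ t' < u ∧ k' ≠ k ∧ Hit n d cl t' i k'

section

variable {W n base u i k : ℕ} {d : ℕ → ℕ} {cl : ℕ → ℕ → ℕ} {μ₀ μ₁ μ : ℕ → ℕ}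

theorem mem_met : k ∈ met n d cl u i ↔ ∃ t < u, Hit n d cl t i k := by
  classical
  simp only [met, Finset.mem_filter, Finset.mem_range, and_iff_right_iff_imp]
  rintro ⟨t, -, -, h, -⟩
  exact h.1

theorem card_met_le : (met n d cl u i).card ≤ n := by
  refine (Finset.card_le_card (t := Finset.range n) fun k hk => ?_).trans (Finset.card_range n).le
  obtain ⟨t, -, hit⟩ := mem_met.1 hk
  exact Finset.mem_range.2 hit.2.1.1

/-- If the lists `i` and `k` have met before and `i` is the wider one, then `k` remembers `i`,
since no other list has met `k` as a row in between. -/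
theorem JoinMem.row_eq (h : JoinMem n base d cl μ₁ u μ) (hu : Hit n d cl u i k)
    (hex : ∃ t < u, Hit n d cl t i k) (hw : wid d k ≤ wid d i) :
    μ (base + 5 * st d k + 2) = base + 5 * st d i := by
  obtain ⟨t, ht, hit⟩ := hex
  rcases h.row_last t ht i k hit hw with h | ⟨t', i', htt', ht', hne, hit'⟩
  · exact h
  · exact absurd (row_eq_of_between hw hit.1 hit.2.1 hu.1 hu.2.1 htt'.le ht'.le hit'.1) hne

theorem JoinMem.col_eq (h : JoinMem n base d cl μ₁ u μ) (hu : Hit n d cl u i k)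
    (hex : ∃ t < u, Hit n d cl t i k) (hw : wid d i ≤ wid d k) :
    μ (base + 5 * st d i + 3) = base + 5 * st d k := by
  obtain ⟨t, ht, hit⟩ := hex
  rcases h.col_last t ht i k hit hw with h | ⟨t', k', htt', ht', hne, hit'⟩
  · exact h
  · exact absurd (col_eq_of_between hw hit.1 hit.2.1 hu.1 hu.2.1 htt'.le ht'.le hit'.2.1) hne

/-- The two words tell whether the lists have been counted before: the narrower of the two lists
remembers the wider one. -/
theorem JoinMem.found_iff (h : JoinMem n base d cl μ₁ u μ) (hu : Hit n d cl u i k) :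
    (μ (base + 5 * st d k + 2) = base + 5 * st d i ∨
      μ (base + 5 * st d i + 3) = base + 5 * st d k) ↔ ∃ t < u, Hit n d cl t i k := by
  constructor
  · rintro (h' | h')
    · exact h.row i k hu.1.2.1 hu.2.1.1 hu.2.1.2.1 h'
    · exact h.col i k hu.1.1 hu.1.2.1 hu.2.1.2.1 h'
  · intro hex
    rcases le_total (wid d k) (wid d i) with hw | hw
    · exact Or.inl (h.row_eq hu hex hw)
    · exact Or.inr (h.col_eq hu hex hw)

/-- A round without a new pair of lists. -/
theorem JoinMem.step_old (h : JoinMem n base d cl μ₁ u μ)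
    (hold : ∀ i k, Hit n d cl u i k → ∃ t < u, Hit n d cl t i k) :
    JoinMem n base d cl μ₁ (u + 1) μ := by
  have hex : ∀ i k, (∃ t < u + 1, Hit n d cl t i k) ↔ ∃ t < u, Hit n d cl t i k := by
    intro i k
    constructor
    · rintro ⟨t, ht, hit⟩
      rcases Nat.lt_succ_iff_lt_or_eq.1 ht with ht | rfl
      · exact ⟨t, ht, hit⟩
      · exact hold i k hit
    · rintro ⟨t, ht, hit⟩
      exact ⟨t, by omega, hit⟩
  refine ⟨h.same, fun i hi hd => ?_, ?_, ?_, ?_, ?_⟩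
  · rw [h.cnt i hi hd]
    congr 1
    ext k
    rw [mem_met, mem_met, hex]
  · simpa only [hex] using h.row
  · simpa only [hex] using h.col
  · intro t ht i k hit hw
    rcases Nat.lt_succ_iff_lt_or_eq.1 ht with ht | rfl
    · rcases h.row_last t ht i k hit hw with h | ⟨t', i', h₁, h₂, h₃⟩
      · exact Or.inl h
      · exact Or.inr ⟨t', i', h₁, by omega, h₃⟩
    · exact Or.inl (h.row_eq hit (hold i k hit) hw)
  · intro t ht i k hit hw
    rcases Nat.lt_succ_iff_lt_or_eq.1 ht with ht | rfl
    · rcases h.col_last t ht i k hit hw with h | ⟨t', i', h₁, h₂, h₃⟩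
      · exact Or.inl h
      · exact Or.inr ⟨t', i', h₁, by omega, h₃⟩
    · exact Or.inl (h.col_eq hit (hold i k hit) hw)

/-- The memory after a new pair of lists has been counted. -/
def countPair (base : ℕ) (d : ℕ → ℕ) (i k : ℕ) (μ : ℕ → ℕ) : ℕ → ℕ :=
  Function.update (Function.update (Function.update μ (base + 5 * st d k + 2) (base + 5 * st d i))
    (base + 5 * st d i + 3) (base + 5 * st d k)) (base + 5 * st d i + 4)
    (μ (base + 5 * st d i + 4) + 1)

/-- A round that visits a new pair of lists. -/
theorem JoinMem.step_new (h : JoinMem n base d cl μ₁ u μ) (hu : Hit n d cl u i k)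
    (hnew : ¬ ∃ t < u, Hit n d cl t i k) :
    JoinMem n base d cl μ₁ (u + 1) (countPair base d i k μ) := by
  have hin := hu.1.1
  have hid := hu.1.2.1
  have hkn := hu.2.1.1
  have hkd := hu.2.1.2.1
  have huniq : ∀ i' k', Hit n d cl u i' k' → i' = i ∧ k' = k := fun i' k' h' =>
    ⟨h'.1.unique hu.1, h'.2.1.unique hu.2.1⟩
  have hrow : ∀ j, d j ≠ 0 → countPair base d i k μ (base + 5 * st d j + 2) =
      if j = k then base + 5 * st d i else μ (base + 5 * st d j + 2) := by
    intro j hj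
    rw [countPair, Function.update_of_ne (by omega), Function.update_of_ne (by omega)]
    split_ifs with hjk
    · rw [hjk, Function.update_self]
    · rw [Function.update_of_ne]
      intro he
      exact hjk (st_inj hj hkd (by omega))
  have hcol : ∀ j, d j ≠ 0 → countPair base d i k μ (base + 5 * st d j + 3) =
      if j = i then base + 5 * st d k else μ (base + 5 * st d j + 3) := by
    intro j hj
    rw [countPair, Function.update_of_ne (by omega)]
    split_ifs with hjk
    · rw [hjk, Function.update_self]
    · rw [Function.update_of_ne, Function.update_of_ne (by omega)]
      intro he
      exact hjk (st_inj hj hid (by omega))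
  refine ⟨fun a ha => ?_, fun j hj hjd => ?_, ?_, ?_, ?_, ?_⟩
  · have h₁ := ha i hin hid
    have h₂ := ha k hkn hkd
    rw [countPair, Function.update_of_ne h₁.2.2, Function.update_of_ne h₁.2.1,
      Function.update_of_ne h₂.1, h.same a ha]
  · by_cases hji : j = i
    · subst hji
      rw [countPair, Function.update_self, h.cnt j hj hjd]
      have : met n d cl (u + 1) j = insert k (met n d cl u j) := by
        ext k'
        rw [Finset.mem_insert, mem_met, mem_met]
        constructor
        · rintro ⟨t, ht, hit⟩
          rcases Nat.lt_succ_iff_lt_or_eq.1 ht with ht | rfl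
          · exact Or.inr ⟨t, ht, hit⟩
          · exact Or.inl (huniq _ _ hit).2
        · rintro (rfl | ⟨t, ht, hit⟩)
          · exact ⟨u, by omega, hu⟩
          · exact ⟨t, by omega, hit⟩
      rw [this, Finset.card_insert_of_notMem (by rwa [mem_met])]
    · have hne : st d j ≠ st d i := fun he => hji (st_inj hjd hid he)
      rw [countPair, Function.update_of_ne (by omega), Function.update_of_ne (by omega),
        Function.update_of_ne (by omega), h.cnt j hj hjd]
      congr 1
      ext k'
      rw [mem_met, mem_met]
      constructor
      · rintro ⟨t, ht, hit⟩
        exact ⟨t, by omega, hit⟩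
      · rintro ⟨t, ht, hit⟩
        rcases Nat.lt_succ_iff_lt_or_eq.1 ht with ht | rfl
        · exact ⟨t, ht, hit⟩
        · exact absurd (huniq _ _ hit).1 hji
  · intro i' k' hi' hk' hkd' he
    rw [hrow k' hkd'] at he
    split_ifs at he with hkk
    · rw [st_inj (d := d) hi' hid (by omega), hkk]
      exact ⟨u, by omega, hu⟩
    · obtain ⟨t, ht, hit⟩ := h.row i' k' hi' hk' hkd' he
      exact ⟨t, by omega, hit⟩
  · intro i' k' hi' hid' hkd' he
    rw [hcol i' hid'] at he
    split_ifs at he with hii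
    · rw [st_inj (d := d) hkd' hkd (by omega), hii]
      exact ⟨u, by omega, hu⟩
    · obtain ⟨t, ht, hit⟩ := h.col i' k' hi' hid' hkd' he
      exact ⟨t, by omega, hit⟩
  · intro t ht i' k' hit hw
    rw [hrow k' hit.2.1.2.1]
    rcases Nat.lt_succ_iff_lt_or_eq.1 ht with ht | rfl
    · by_cases hkk : k' = k
      · rw [if_pos hkk]
        by_cases hii : i' = i
        · rw [hii]; exact Or.inl rfl
        · exact Or.inr ⟨u, i, ht, by omega, Ne.symm hii, hkk ▸ hu⟩
      · rw [if_neg hkk]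
        rcases h.row_last t ht i' k' hit hw with h | ⟨t', i', h₁, h₂, h₃⟩
        · exact Or.inl h
        · exact Or.inr ⟨t', i', h₁, by omega, h₃⟩
    · obtain ⟨rfl, rfl⟩ := huniq _ _ hit
      rw [if_pos rfl]
      exact Or.inl rfl
  · intro t ht i' k' hit hw
    rw [hcol i' hit.1.2.1]
    rcases Nat.lt_succ_iff_lt_or_eq.1 ht with ht | rfl
    · by_cases hii : i' = i
      · rw [if_pos hii]
        by_cases hkk : k' = k
        · rw [hkk]; exact Or.inl rfl
        · exact Or.inr ⟨u, k, ht, by omega, Ne.symm hkk, hii ▸ hu⟩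
      · rw [if_neg hii]
        rcases h.col_last t ht i' k' hit hw with h | ⟨t', i', h₁, h₂, h₃⟩
        · exact Or.inl h
        · exact Or.inr ⟨t', i', h₁, by omega, h₃⟩
    · obtain ⟨rfl, rfl⟩ := huniq _ _ hit
      rw [if_pos rfl]
      exact Or.inl rfl

theorem Filled.joinMem (h : Filled base d cl μ₀ n 0 μ₁) : JoinMem n base d cl μ₁ 0 μ₁ := by
  have hz : ∀ j c, 2 ≤ c → c < 5 → μ₁ (base + 5 * st d j + c) = 0 := by
    intro j c h₁ h₂
    exact h.zero _ (by omega) fun j' r hw => by omega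
  have hlt : ∀ i, 0 < st d i := fun i => (Nat.zero_le _).trans_lt (four_mul_off_lt_st i)
  refine ⟨fun _ _ => rfl, fun i hi hd => ?_, ?_, ?_, ?_, ?_⟩
  · rw [hz i 4 (by omega) (by omega), eq_comm, Finset.card_eq_zero,
      Finset.eq_empty_iff_forall_notMem]
    intro k hk
    rw [mem_met] at hk
    obtain ⟨t, ht, -⟩ := hk
    omega
  · intro i k _ _ _ he
    rw [hz k 2 (by omega) (by omega)] at he
    have := hlt i
    omega
  · intro i k _ _ _ he
    rw [hz i 3 (by omega) (by omega)] at he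
    have := hlt k
    omega
  · intro t ht
    omega
  · intro t ht
    omega

/-- The records are still in place at time `u`. -/
theorem JoinMem.read_of_occ (hf : Filled base d cl μ₀ n 0 μ₁) (h : JoinMem n base d cl μ₁ u μ)
    {p : ℕ} (hp : Occ n d p i) :
    μ (base + 5 * p) = base + 5 * st d i ∧ μ (base + 5 * p + 1) = cl i (p - st d i) := by
  have hw : Written d n 0 i (p - st d i) :=
    ⟨Or.inl hp.1, hp.2.1, by have := hp.2.2.2; omega⟩
  have he : st d i + (p - st d i) = p := Nat.add_sub_cancel' hp.2.2.1
  have h₁ := hf.head i _ hw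
  have h₂ := hf.val i _ hw
  rw [he] at h₁ h₂
  rw [h.same _ (fun j _ _ => by omega), h.same _ (fun j _ _ => by omega)]
  exact ⟨h₁, h₂⟩

theorem JoinMem.read_of_not_occ (hf : Filled base d cl μ₀ n 0 μ₁)
    (h : JoinMem n base d cl μ₁ u μ) {p : ℕ} (hp : ¬ ∃ i, Occ n d p i) :
    μ (base + 5 * p) = 0 := by
  rw [h.same _ (fun j _ _ => by omega)]
  refine hf.zero _ (by omega) fun j r hw => ?_
  have : p ≠ st d j + r := by
    rintro rfl
    refine hp ⟨j, ?_, hw.2.1, Nat.le_add_right _ _, by have := hw.2.2; omega⟩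
    have := hw.1
    omega
  omega

theorem wp_visit {Q : List ℕ → State → Prop} {s : State} (hc : Consts n base s)
    (hin : Input W n base d cl μ₀) (hf : Filled base d cl μ₀ n 0 μ₁)
    (h : JoinMem n base d cl μ₁ u s.mem) (hP : s.reg rP = evenBits u)
    (hQ' : s.reg rQ = evenBits (u / 2)) (hPw : evenBits u < 2 ^ (4 * off d n).size)
    (hQw : evenBits (u / 2) < 2 ^ (4 * off d n).size)
    (hQ : ∀ t (s' : State), (∀ a ∈ t, a ∈ roundAddrs n d base u) →
      JoinMem n base d cl μ₁ (u + 1) s'.mem →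
      (∀ y, y ≠ rX → y ≠ rY → y ≠ rH → y ≠ rG → y ≠ rV → y ≠ rF → y ≠ rK → y ≠ rA →
        s'.reg y = s.reg y) → Q t s') :
    wp W visit Q s := by
  have hword := hin.word
  have hbig : 4 * off d n < 2 ^ (4 * off d n).size := Nat.lt_size_self _
  have hrow : ∀ c, c ≤ 4 → base + 5 * evenBits u + c ∈ roundAddrs n d base u :=
    fun c hc => ⟨_, ⟨_, Or.inl rfl, Or.inl rfl⟩, by omega, by omega⟩
  have hcol : ∀ c, c ≤ 4 → base + 5 * evenBits (u / 2) + c ∈ roundAddrs n d base u :=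
    fun c hc => ⟨_, ⟨_, Or.inr rfl, Or.inl rfl⟩, by omega, by omega⟩
  have hrow₀ := hrow 0 (by omega)
  have hcol₀ := hcol 0 (by omega)
  rw [Nat.add_zero] at hrow₀ hcol₀
  have hone := ite_one_lt (W := W) (by omega)
  simp (disch := decide) only [visit, wp_block_cons, wp_block_nil, wp_op, wp_load, wp_ite,
    State.reg_setReg_self, State.reg_setReg_of_ne, State.mem_setReg, BinOp.eval, hP, hQ', hc.five,
    hc.base]
  refine ⟨by omega, by omega, by omega, by omega, ?_⟩
  by_cases hoi : ∃ i, Occ n d (evenBits u) i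
  swap
  · have e := h.read_of_not_occ hf hoi
    refine ⟨fun h => absurd e h, fun _ => ?_⟩
    simp only [wp, List.nil_append, List.cons_append, List.append_nil]
    refine hQ _ _ (by simp [hrow₀, hcol₀]) ?_ ?_
    · exact h.step_old fun i k hit => absurd ⟨i, hit.1⟩ hoi
    · intro y h₁ h₂ h₃ h₄ h₅ h₆ h₇ h₈
      simp only [h₁, h₂, h₃, h₄, State.reg_setReg_of_ne, ne_eq, not_false_eq_true]
  obtain ⟨i, hi⟩ := hoi
  obtain ⟨e₁, e₂⟩ := h.read_of_occ hf hi
  have hbase := hin.base_eq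
  rw [e₁]
  refine ⟨fun _ => ?_, fun h => absurd h (by omega)⟩
  by_cases hok : ∃ k, Occ n d (evenBits (u / 2)) k
  swap
  · have e := h.read_of_not_occ hf hok
    refine ⟨fun h => absurd e h, fun _ => ?_⟩
    simp only [wp, List.nil_append, List.cons_append, List.append_nil]
    refine hQ _ _ (by simp [hrow₀, hcol₀]) ?_ ?_
    · exact h.step_old fun i k hit => absurd ⟨k, hit.2.1⟩ hok
    · intro y h₁ h₂ h₃ h₄ h₅ h₆ h₇ h₈
      simp only [h₁, h₂, h₃, h₄, State.reg_setReg_of_ne, ne_eq, not_false_eq_true]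
  obtain ⟨k, hk⟩ := hok
  obtain ⟨e₃, e₄⟩ := h.read_of_occ hf hk
  rw [e₃]
  refine ⟨fun _ => ?_, fun h => absurd h (by omega)⟩
  have hsti := hi.start.lt_off
  have hstk := hk.start.lt_off
  have hhi : ∀ c, c ≤ 4 → base + 5 * st d i + c ∈ roundAddrs n d base u :=
    fun c hc => ⟨_, ⟨_, Or.inl rfl, Or.inr ⟨i, hi, rfl⟩⟩, by omega, by omega⟩
  have hhk : ∀ c, c ≤ 4 → base + 5 * st d k + c ∈ roundAddrs n d base u :=
    fun c hc => ⟨_, ⟨_, Or.inr rfl, Or.inr ⟨k, hk, rfl⟩⟩, by omega, by omega⟩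
  simp (disch := decide) only [
    hc.one, hc.two, e₂, e₄, hone, true_and]
  refine ⟨by omega, by omega, ?_⟩
  have huniq : ∀ i' k', Hit n d cl u i' k' → i' = i ∧ k' = k := fun i' k' h' =>
    ⟨h'.1.unique hi, h'.2.1.unique hk⟩
  by_cases hval : cl i (evenBits u - st d i) = cl k (evenBits (u / 2) - st d k)
  swap
  · rw [if_neg hval]
    refine ⟨fun h => absurd rfl h, fun _ => ?_⟩
    simp only [wp, List.nil_append, List.cons_append, List.append_nil]
    refine hQ _ _ (by simp [hrow₀, hcol₀, hrow 1, hcol 1]) ?_ ?_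
    · refine h.step_old fun i' k' hit => ?_
      obtain ⟨rfl, rfl⟩ := huniq _ _ hit
      exact absurd hit.2.2 hval
    · intro y h₁ h₂ h₃ h₄ h₅ h₆ h₇ h₈
      simp only [h₁, h₂, h₃, h₄, h₅, h₆, h₇, State.reg_setReg_of_ne, ne_eq, not_false_eq_true]
  have hit : Hit n d cl u i k := ⟨hi, hk, hval⟩
  have hfound := h.found_iff hit
  have hcnt := h.cnt i hi.1 hi.2.1
  have hle := card_met_le (n := n) (d := d) (cl := cl) (u := u) (i := i)
  rw [if_pos hval]
  refine ⟨fun _ => ?_, fun h => absurd h one_ne_zero⟩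
  refine ⟨by omega, by omega, by omega, ?_, ?_, ?_⟩
  · split_ifs <;> omega
  all_goals rw [show base + 5 * st d i + 2 + 1 = base + 5 * st d i + 3 from rfl]
  · intro hne
    simp only [wp, List.nil_append, List.cons_append, List.append_nil]
    refine hQ _ _ (by simp [hrow₀, hcol₀, hrow 1, hcol 1, hhk 2, hhi 3]) ?_ ?_
    · refine h.step_old fun i' k' hit => ?_
      obtain ⟨rfl, rfl⟩ := huniq _ _ hit
      refine hfound.1 ?_
      by_contra hno
      rw [not_or] at hno
      simp [hno.1, hno.2] at hne
    · intro y h₁ h₂ h₃ h₄ h₅ h₆ h₇ h₈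
      simp only [h₁, h₂, h₃, h₄, h₅, h₆, h₇, h₈, State.reg_setReg_of_ne, ne_eq, not_false_eq_true]
  · intro heq
    have hnew : ¬ ∃ t < u, Hit n d cl t i k := by
      rw [← hfound]
      rintro (h' | h') <;> simp [h'] at heq
    simp (disch := decide) only [wp_store, State.reg_setReg_self, State.reg_setReg_of_ne,
      State.reg_setMem, State.mem_setReg, State.mem_setMem, hc.one, hc.four, List.nil_append,
      List.cons_append, List.append_nil]
    rw [Function.update_of_ne (by omega), Function.update_of_ne (by omega)]
    refine ⟨by omega, by omega, ?_⟩
    refine hQ _ _ (by simp [hrow₀, hcol₀, hrow 1, hcol 1, hhk 2, hhi 3, hhi 4]) ?_ ?_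
    · simpa only [State.mem_setReg, State.mem_setMem, countPair] using h.step_new hit hnew
    · intro y h₁ h₂ h₃ h₄ h₅ h₆ h₇ h₈
      simp only [h₁, h₂, h₃, h₄, h₅, h₆, h₇, h₈, State.reg_setReg_of_ne, State.reg_setMem, ne_eq,
        not_false_eq_true]

/-- The invariant of the Morton order. -/
structure JoinInv (n base : ℕ) (d : ℕ → ℕ) (cl : ℕ → ℕ → ℕ) (μ₁ : ℕ → ℕ) (u : ℕ) (t : List ℕ)
    (s : State) : Prop where
  consts : Consts n base s
  reg_w : s.reg rW = 2 ^ (4 * off d n).size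
  reg_t : s.reg rT = u
  reg_tt : s.reg rTT = 4 ^ (4 * off d n).size
  reg_c : s.reg rC = if u < 4 ^ (4 * off d n).size then 1 else 0
  mem : JoinMem n base d cl μ₁ u s.mem
  pieced : Pieced (roundAddrs n d base) u t

theorem wp_join {Q : List ℕ → State → Prop} {s : State} (hc : Consts n base s)
    (hin : Input W n base d cl μ₀) (hf : Filled base d cl μ₀ n 0 s.mem) (ho : s.reg rO = off d n)
    (hQ : ∀ t s', JoinInv n base d cl s.mem (4 ^ (4 * off d n).size) t s' → Q t s') :
    wp W join Q s := by
  have hword := hin.word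
  have hbig : 4 * off d n < 2 ^ (4 * off d n).size := Nat.lt_size_self _
  have h4 : 2 ^ (4 * off d n).size * 2 ^ (4 * off d n).size = 4 ^ (4 * off d n).size := by
    rw [← mul_pow]; norm_num
  have hone := ite_one_lt (W := W) (by omega)
  rw [h4] at hword
  simp (disch := decide) only [join, wp_block_cons, wp_op, BinOp.eval, hc.four, ho]
  refine ⟨by omega, ?_⟩
  refine wp_powAbove (by decide) ?_ ?_ ?_ ?_
  · simp (disch := decide) only [State.reg_setReg_of_ne, hc.one]
  · simp only [State.reg_setReg_self]; omega
  · simp only [State.reg_setReg_self]; omega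
  intro s₁ hm₁ hw₁ hf₁
  simp only [State.reg_setReg_self] at hw₁
  simp only [State.mem_setReg] at hm₁
  have f₁ : Consts n base s₁ := by
    constructor <;> rw [hf₁ _ (by decide) (by decide) (by decide)] <;>
      simp (disch := decide) only [State.reg_setReg_of_ne, hc.one, hc.two, hc.four,
      hc.five, hc.n, hc.base]
  simp (disch := decide) only [State.reg_setReg_self, State.reg_setReg_of_ne, wp_const, hw₁, h4,
    hone, true_and]
  refine ⟨by omega, by omega, ?_⟩
  refine wp_loop_range (4 ^ (4 * off d n).size) (JoinInv n base d cl s.mem) ?_ ?_ ?_ ?_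
  · intro u t s' _ h
    rw [h.reg_c]
    simp
  · intro u t s' hu h
    rw [wp_block_cons]
    refine wp_decode h.consts (by rw [h.reg_t]; omega) ?_
    intro s₂ hm₂ hp₂ hq₂ hf₂
    rw [wp_block_cons]
    rw [h.reg_t] at hp₂ hq₂
    have c₂ : Consts n base s₂ := by
      constructor <;>
        rw [hf₂ _ (by decide) (by decide) (by decide) (by decide) (by decide)] <;>
        simp only [h.consts.one, h.consts.two, h.consts.four, h.consts.five, h.consts.n,
          h.consts.base]
    refine wp_visit c₂ hin hf (by rw [hm₂]; exact h.mem) hp₂ hq₂ (evenBits_lt hu)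
      (evenBits_lt (by omega)) ?_
    intro t₃ s₃ ht₃ hm₃ hf₃
    have f₃ : ∀ y, y ≠ rP → y ≠ rQ → y ≠ rU → y ≠ rZ → y ≠ rX → y ≠ rY → y ≠ rH → y ≠ rG →
        y ≠ rV → y ≠ rF → y ≠ rK → y ≠ rA → s₃.reg y = s'.reg y := by
      intro y h₁ h₂ h₃ h₄ h₅ h₆ h₇ h₈ h₉ h₁₀ h₁₁ h₁₂
      rw [hf₃ y h₅ h₆ h₇ h₈ h₉ h₁₀ h₁₁ h₁₂, hf₂ y h₁ h₂ h₃ h₄ h₁₁]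
    have c := h.consts
    simp (disch := decide) only [wp_block_cons, wp_block_nil, wp_op, State.reg_setReg_self,
      State.reg_setReg_of_ne, BinOp.eval, f₃, h.reg_t, h.reg_tt, c.one, hone, true_and,
      List.append_nil, List.nil_append]
    refine ⟨by omega, ⟨?_, ?_, ?_, ?_, ?_, ?_⟩, ?_, ?_, ?_, ?_, hm₃, h.pieced.succ ht₃⟩
    all_goals simp (disch := decide) only [State.reg_setReg_self, State.reg_setReg_of_ne, f₃, c.one,
      c.two, c.four, c.five, c.n, c.base, h.reg_w, h.reg_tt]
  · intro t s' h
    simpa only [wp_block_nil, List.append_nil, List.nil_append] using hQ t s' h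
  · refine ⟨⟨?_, ?_, ?_, ?_, ?_, ?_⟩, ?_, ?_, ?_, ?_, ?_, .zero⟩
    all_goals try simp (disch := decide) only [State.reg_setReg_self, State.reg_setReg_of_ne,
      State.mem_setReg, f₁.one, f₁.two, f₁.four, f₁.five, f₁.n, f₁.base, hw₁, hm₁]
    exact hf.joinMem

end

/-- The two output arrays, from `bT` and `bS` on, hold the rows of the vertices before `i`, when
`ball j` is the number of vertices at distance at most `2` from `j`. -/
structure Rows (n bT bS : ℕ) (d ball : ℕ → ℕ) (i : ℕ) (μ : ℕ → ℕ) : Prop where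
  rowT : ∀ j < i, μ (bT + 3 * j) = 1 ∧ μ (bT + 3 * j + 1) = d j + 1 ∧ μ (bT + 3 * j + 2) = ball j
  rowS : ∀ j < i, μ (bS + 4 * j) = 1 ∧ μ (bS + 4 * j + 1) = d j ∧
    μ (bS + 4 * j + 2) = ball j - (d j + 1) ∧ μ (bS + 4 * j + 3) = n - ball j

/-- The invariant of the loop that writes the output. -/
structure OutInv (n base bT bS : ℕ) (d ball : ℕ → ℕ) (μ₂ : ℕ → ℕ) (i : ℕ) (t : List ℕ)
    (s : State) : Prop where
  consts : Consts n base s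
  reg_i : s.reg rI = i
  reg_o : s.reg rO = off d i
  reg_x : s.reg rX = bT + 3 * i
  reg_y : s.reg rY = bS + 4 * i
  reg_bt : s.reg rBT = bT
  reg_bs : s.reg rBS = bS
  reg_c : s.reg rC = if i < n then 1 else 0
  reg_c1 : s.reg rC1 = ((Finset.range i).filter fun j => d j + 1 = n).card
  reg_c2 : s.reg rC2 = ((Finset.range i).filter fun j => ball j = n).card
  low : ∀ a < bT, s.mem a = μ₂ a
  rows : Rows n bT bS d ball i s.mem
  scan : Scan ![1, base, bT, bS] t ![i + 1, base + 5 * (4 * off d i), bT + 3 * i, bS + 4 * i]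

theorem card_filter_range_succ (p : ℕ → Prop) [DecidablePred p] (i : ℕ) :
    ((Finset.range (i + 1)).filter p).card =
      ((Finset.range i).filter p).card + if p i then 1 else 0 := by
  rw [Finset.range_add_one, Finset.filter_insert]
  split_ifs
  · rw [Finset.card_insert_of_notMem (by simp)]
  · rfl

theorem card_filter_range_le (p : ℕ → Prop) [DecidablePred p] (i : ℕ) :
    ((Finset.range i).filter p).card ≤ i := by
  simpa using Finset.card_filter_le (Finset.range i) p

section

variable {W n base bT bS : ℕ} {d ball : ℕ → ℕ} {cl : ℕ → ℕ → ℕ} {μ₀ μ₂ μ : ℕ → ℕ}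

theorem Rows.write {i : ℕ} (h : Rows n bT bS d ball i μ) (hi : i < n) (hS : bS = bT + n + n + n) :
    Rows n bT bS d ball (i + 1)
      (Function.update (Function.update (Function.update (Function.update (Function.update
        (Function.update (Function.update μ (bT + 3 * i) 1) (bT + 3 * i + 1) (d i + 1))
        (bT + 3 * i + 1 + 1) (ball i)) (bS + 4 * i) 1) (bS + 4 * i + 1) (d i))
        (bS + 4 * i + 1 + 1) (ball i - (d i + 1))) (bS + 4 * i + 1 + 1 + 1) (n - ball i)) := by
  subst hS
  constructor
  · intro j hj
    rcases Nat.lt_succ_iff_lt_or_eq.1 hj with hj | rfl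
    · have := h.rowT j hj
      simp (disch := omega) only [Function.update_of_ne, this, and_self]
    · simp (disch := omega) only [Function.update_of_ne, Function.update_self, and_self]
  · intro j hj
    rcases Nat.lt_succ_iff_lt_or_eq.1 hj with hj | rfl
    · have := h.rowS j hj
      simp (disch := omega) only [Function.update_of_ne, this, and_self]
    · simp (disch := omega) only [Function.update_of_ne, Function.update_self, and_self]

theorem wp_writeRow {i : ℕ} {t : List ℕ} {s s₁ : State}
    (hword : bS + 4 * n + 10 < W) (hS : bS = bT + n + n + n) (hball : ball i ≤ n) (hdn : d i ≤ n)
    (hi : i < n) (h : OutInv n base bT bS d ball μ₂ i t s) (hm : s₁.mem = s.mem)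
    (hd : s₁.reg rD = d i) (hv : s₁.reg rV = ball i)
    (hf : ∀ y, y ≠ rW → y ≠ rE → y ≠ rK → y ≠ rH → y ≠ rD → y ≠ rA → y ≠ rV →
      s₁.reg y = s.reg y) {t₁ : List ℕ}
    (ht : Scan ![i + 1, base + 5 * (4 * off d i), bT + 3 * i, bS + 4 * i] t₁
      ![i + 1 + 1, base + 5 * (4 * off d (i + 1)), bT + 3 * i, bS + 4 * i])
    (hoff : off d (i + 1) ≤ n * n) (hnn : n * n < W) :
    wp W writeRow (fun t' s' => OutInv n base bT bS d ball μ₂ (i + 1) (t ++ (t₁ ++ t')) s') s₁ := by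
  have hc := h.consts
  have hone := ite_one_lt (W := W) (by omega)
  have hc1 := card_filter_range_le (fun j => d j + 1 = n) i
  have hc2 := card_filter_range_le (fun j => ball j = n) i
  have hle : ∀ p : Prop, ∀ [Decidable p], (if p then 1 else 0) ≤ 1 := by
    intro p _; split_ifs <;> omega
  have hle₁ := hle (d i + 1 = n)
  have hle₂ := hle (ball i = n)
  have hoff' := off_succ (d := d) i
  simp (disch := decide) only [writeRow, wp_block_cons, wp_block_nil, wp_op, wp_store,
    State.reg_setReg_self, State.reg_setReg_of_ne, State.reg_setMem,
    BinOp.eval, hf, hc.one, hc.n, hd, hv, h.reg_i, h.reg_o, h.reg_x, h.reg_y,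
    h.reg_c1, h.reg_c2, hone, true_and, List.nil_append, List.cons_append, List.append_nil]
  refine ⟨by omega, by omega, by omega, by omega, by omega, by omega, by omega, by omega, by omega,
    by omega, by omega, by omega, by omega, by omega, ?_⟩
  refine ⟨⟨?_, ?_, ?_, ?_, ?_, ?_⟩, ?_, ?_, ?_, ?_, ?_, ?_, ?_, ?_, ?_, ?_, ?_, ?_⟩
  all_goals try simp (disch := decide) only [State.reg_setReg_self, State.reg_setReg_of_ne,
    State.mem_setReg, State.reg_setMem, State.mem_setMem, hf, hc.one, hc.two, hc.four, hc.five,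
    hc.n, hc.base, hoff', h.reg_bt, h.reg_bs, card_filter_range_succ, hm]
  · ring
  · ring
  · intro a ha
    rw [← h.low a ha]
    simp (disch := omega) only [Function.update_of_ne]
  · exact h.rows.write hi hS
  · rw [hoff'] at ht
    refine h.scan.append (ht.append ?_)
    refine .cons' 2 _ (vec4_le.2 ⟨le_rfl, le_rfl, le_rfl, le_rfl⟩) (by simp) (by simp) ?_
    refine .cons' 2 ![i + 1 + 1, base + 5 * (4 * (off d i + d i)), bT + 3 * i + 1, bS + 4 * i]
      (vec4_le.2 (by omega)) (by simp) (by simp) ?_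
    refine .cons' 2 ![i + 1 + 1, base + 5 * (4 * (off d i + d i)), bT + 3 * (i + 1), bS + 4 * i]
      (vec4_le.2 (by omega)) (by simp) (by simp; omega) ?_
    refine .cons' 3 _ (vec4_le.2 ⟨le_rfl, le_rfl, le_rfl, le_rfl⟩) (by simp) (by simp) ?_
    refine .cons' 3 ![i + 1 + 1, base + 5 * (4 * (off d i + d i)), bT + 3 * (i + 1), bS + 4 * i + 1]
      (vec4_le.2 (by omega)) (by simp) (by simp) ?_
    refine .cons' 3 ![i + 1 + 1, base + 5 * (4 * (off d i + d i)), bT + 3 * (i + 1), bS + 4 * i + 2]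
      (vec4_le.2 (by omega)) (by simp) (by simp) ?_
    refine .cons' 3 ![i + 1 + 1, base + 5 * (4 * (off d i + d i)), bT + 3 * (i + 1),
      bS + 4 * (i + 1)] (vec4_le.2 (by omega)) (by simp) (by simp; omega) ?_
    exact .nil le_rfl

theorem wp_outputRow {i : ℕ} {t : List ℕ} {s : State} (hin : Input W n base d cl μ₀)
    (hT : bT = base + 5 * 2 ^ (4 * off d n).size) (hS : bS = bT + n + n + n)
    (hdeg : ∀ j < n, μ₂ (j + 1) = d j)
    (hball : ∀ j < n, d j ≠ 0 → μ₂ (base + 5 * st d j + 4) = ball j)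
    (hball₀ : ∀ j < n, d j = 0 → ball j = 1) (hball' : ∀ j < n, ball j ≤ n)
    (hdn : ∀ j < n, d j ≤ n) (hi : i < n) (h : OutInv n base bT bS d ball μ₂ i t s) :
    wp W outputRow (fun t' s' => OutInv n base bT bS d ball μ₂ (i + 1) (t ++ t') s') s := by
  have hc := h.consts
  have hword := hin.word
  have hbase := hin.le_base
  have hbase' := hin.base_eq
  have hoff := off_mono (d := d) (show i + 1 ≤ n from hi)
  have hoff' := off_succ (d := d) i
  have hwid := lt_wid (d := d) i
  have hwid' := four_mul_off_add_wid_le (d := d) hi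
  have hlt := four_mul_off_lt_st (d := d) i
  have hbig : 4 * off d n < 2 ^ (4 * off d n).size := Nat.lt_size_self _
  have hmem : s.mem (i + 1) = d i := by rw [h.low _ (by omega), hdeg i hi]
  simp (disch := decide) only [outputRow, wp_block_cons, wp_op, wp_load,
    State.reg_setReg_self, State.mem_setReg, BinOp.eval, hc.one, h.reg_i,
    hmem]
  refine ⟨by omega, ?_⟩
  refine wp_headAddr (i := i) (n := n) (base := base) (d := d) ?_ ?_ ?_ (by omega) ?_
  · constructor <;> simp (disch := decide) only [State.reg_setReg_of_ne, hc.one, hc.two, hc.four,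
      hc.five, hc.n, hc.base]
  · simp (disch := decide) only [State.reg_setReg_self]
  · simp (disch := decide) only [State.reg_setReg_of_ne, h.reg_o]
  intro s₁ hm₁ hh₁ hf₁
  simp only [State.mem_setReg] at hm₁
  have hf : ∀ y, y ≠ rW → y ≠ rE → y ≠ rK → y ≠ rH → y ≠ rD → y ≠ rA → s₁.reg y = s.reg y := by
    intro y h₁ h₂ h₃ h₄ h₅ h₆
    rw [hf₁ y h₁ h₂ h₃ h₄, State.reg_setReg_of_ne _ _ h₅, State.reg_setReg_of_ne _ _ h₆]
  have hd₁ : s₁.reg rD = d i := by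
    rw [hf₁ _ (by decide) (by decide) (by decide) (by decide)]
    simp (disch := decide) only [State.reg_setReg_self]
  simp (disch := decide) only [wp_const, wp_ite, wp_block_cons, wp_block_nil, wp_op, wp_load,
    State.reg_setReg_self, State.reg_setReg_of_ne, State.mem_setReg, BinOp.eval, hd₁, hh₁, hf,
    hc.four, hm₁, List.append_nil, List.nil_append, List.cons_append]
  refine ⟨by omega, fun hd => ?_, fun hd => ?_⟩
  · have hst := st_add_wid_le hd
    refine ⟨by omega, ?_⟩
    have hv : s.mem (base + 5 * st d i + 4) = ball i := by
      rw [h.low _ (by omega), hball i hi hd]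
    rw [hv]
    refine wp_writeRow (by omega) hS (hball' i hi) (hdn i hi) hi h ?_ ?_ ?_ ?_
      (t₁ := [i + 1, base + 5 * st d i + 4]) ?_ (by omega) (by omega)
    · simpa only [State.mem_setReg] using hm₁
    · simp (disch := decide) only [State.reg_setReg_of_ne, hd₁]
    · simp (disch := decide) only [State.reg_setReg_self]
    · intro y h₁ h₂ h₃ h₄ h₅ h₆ h₇
      simp only [h₆, h₇, State.reg_setReg_of_ne, ne_eq, not_false_eq_true, hf y h₁ h₂ h₃ h₄ h₅ h₆]
    · refine .cons' 0 _ (vec4_le.2 ⟨le_rfl, le_rfl, le_rfl, le_rfl⟩) (by simp) (by simp) ?_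
      refine .cons' 1 ![i + 1, base + 5 * st d i + 4, bT + 3 * i, bS + 4 * i]
        (vec4_le.2 (by omega)) (by simp; omega) (by simp) ?_
      exact .nil (vec4_le.2 (by omega))
  · simp only [wp]
    refine wp_writeRow (by omega) hS (hball' i hi) (hdn i hi) hi h ?_ ?_ ?_ ?_
      (t₁ := [i + 1]) ?_ (by omega) (by omega)
    · simpa only [State.mem_setReg] using hm₁
    · simp (disch := decide) only [State.reg_setReg_of_ne, hd₁]
    · simp (disch := decide) only [State.reg_setReg_self, hball₀ i hi hd]
    · intro y h₁ h₂ h₃ h₄ h₅ h₆ h₇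
      simp only [h₇, State.reg_setReg_of_ne, ne_eq, not_false_eq_true, hf y h₁ h₂ h₃ h₄ h₅ h₆]
    · refine .cons' 0 _ (vec4_le.2 ⟨le_rfl, le_rfl, le_rfl, le_rfl⟩) (by simp) (by simp) ?_
      exact .nil (vec4_le.2 (by omega))

theorem wp_output {Q : List ℕ → State → Prop} {s : State} (hin : Input W n base d cl μ₀)
    (hT : bT = base + 5 * 2 ^ (4 * off d n).size) (hS : bS = bT + n + n + n)
    (hdeg : ∀ j < n, s.mem (j + 1) = d j)
    (hball : ∀ j < n, d j ≠ 0 → s.mem (base + 5 * st d j + 4) = ball j)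
    (hball₀ : ∀ j < n, d j = 0 → ball j = 1) (hball' : ∀ j < n, ball j ≤ n)
    (hdn : ∀ j < n, d j ≤ n) (hc : Consts n base s) (hw : s.reg rW = 2 ^ (4 * off d n).size)
    (hQ : ∀ t s', OutInv n base bT bS d ball s.mem n t s' → Q t s') : wp W output Q s := by
  have hword := hin.word
  have hone := ite_one_lt (W := W) (by omega)
  simp (disch := decide) only [output, wp_block_cons, wp_op, wp_const,
    State.reg_setReg_self, State.reg_setReg_of_ne, BinOp.eval, hc.five, hc.base, hc.n, hw, ← hT,
    ← hS, hone, true_and]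
  refine ⟨by omega, by omega, by omega, by omega, by omega, by omega, by omega, by omega, by omega,
    by omega, by omega, ?_⟩
  refine wp_loop_range n (OutInv n base bT bS d ball s.mem) ?_ ?_ ?_ ?_
  · intro i t s' _ h
    rw [h.reg_c]
    simp
  · intro i t s' hi h
    exact wp_outputRow hin hT hS hdeg hball hball₀ hball' hdn hi h
  · intro t s' h
    simpa only [wp_block_nil, List.append_nil, List.nil_append] using hQ t s' h
  · refine ⟨⟨?_, ?_, ?_, ?_, ?_, ?_⟩, ?_, ?_, ?_, ?_, ?_, ?_, ?_, ?_, ?_, ?_, ?_, ?_⟩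
    all_goals try simp (disch := decide) only [State.reg_setReg_self, State.reg_setReg_of_ne,
      State.mem_setReg, hc.one, hc.two, hc.four, hc.five, hc.n, hc.base]
    · simp [off]
    · rfl
    · rfl
    · intro a _; trivial
    · exact ⟨fun j hj => by omega, fun j hj => by omega⟩
    · exact .nil (vec4_le.2 (by simp [off]))

end

/-! ### Adjacency lists and distances -/

/-- Entry `r` of list `i` stands behind the entries of the lists before. -/
theorem getD_flatten (L : List (List ℕ)) (i r : ℕ) (hr : r < (L.getD i []).length) :
    L.flatten.getD (∑ j ∈ Finset.range i, (L.getD j []).length + r) 0 = (L.getD i []).getD r 0 := by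
  induction L generalizing i with
  | nil => simp at hr
  | cons l L ih =>
    rw [List.flatten_cons]
    cases i with
    | zero =>
      simp only [Finset.range_zero, Finset.sum_empty, Nat.zero_add, List.getD_cons_zero] at hr ⊢
      exact List.getD_append _ _ _ _ hr
    | succ i =>
      rw [Finset.sum_range_succ']
      simp only [List.getD_cons_succ, List.getD_cons_zero] at hr ⊢
      rw [List.getD_append_right _ _ _ _ (by omega), ← ih i hr]
      congr 1
      omega

section

variable {n : ℕ} {G : SimpleGraph (Fin n)} (adj : Fin n → List (Fin n))

/-- The neighbours of vertex `i`, as natural numbers; there are none if `i` is not a vertex. -/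
def nbrs (i : ℕ) : List ℕ := (List.ofFn fun i => (adj i).map Fin.val).getD i []

/-- The degree of vertex `i`, and `0` if `i` is not a vertex. -/
def deg (i : ℕ) : ℕ := (nbrs adj i).length

/-- Entry `r` of the list of `i` itself followed by its neighbours. -/
def closedNbrs (i r : ℕ) : ℕ := if r = 0 then i else (nbrs adj i).getD (r - 1) 0

theorem nbrs_val (i : Fin n) : nbrs adj i = (adj i).map Fin.val := by
  rw [nbrs, List.getD_eq_getElem _ _ (by simp), List.getElem_ofFn]

theorem deg_val (i : Fin n) : deg adj i = (adj i).length := by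
  rw [deg, nbrs_val, List.length_map]

theorem exists_closedNbrs_eq_iff (i : Fin n) (x : ℕ) :
    (∃ r ≤ deg adj i, closedNbrs adj i r = x) ↔ ∃ j : Fin n, (j = i ∨ j ∈ adj i) ∧ (j : ℕ) = x := by
  constructor
  · rintro ⟨r, hr, rfl⟩
    rw [closedNbrs]
    split_ifs with h₀
    · exact ⟨i, Or.inl rfl, rfl⟩
    · have hr' : r - 1 < (nbrs adj i).length := by rw [deg] at hr; omega
      have hmem := List.getElem_mem hr'
      rw [List.getD_eq_getElem _ _ hr']
      generalize (nbrs adj i)[r - 1] = x at hmem ⊢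
      rw [nbrs_val, List.mem_map] at hmem
      obtain ⟨j, hj, he⟩ := hmem
      exact ⟨j, Or.inr hj, he⟩
  · rintro ⟨j, rfl | hj, rfl⟩
    · exact ⟨0, Nat.zero_le _, rfl⟩
    · have : (j : ℕ) ∈ nbrs adj i := by
        rw [nbrs_val]
        exact List.mem_map_of_mem hj
      obtain ⟨r, hr, he⟩ := List.getElem_of_mem this
      refine ⟨r + 1, hr, ?_⟩
      rw [closedNbrs, if_neg (Nat.succ_ne_zero r), Nat.add_sub_cancel, List.getD_eq_getElem _ _ hr,
        he]

theorem initState_mem (a : ℕ) : (initState adj).mem a = (encode adj).getD a 0 := rfl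

theorem initState_mem_add (x : ℕ) : (initState adj).mem (1 + n + x) =
    (List.ofFn fun i => (adj i).map Fin.val).flatten.getD x 0 := by
  rw [initState_mem, encode, show 1 + n + x = n + x + 1 by omega, List.getD_cons_succ,
    List.getD_append_right _ _ _ _ (by simp)]
  simp [List.map_eq_flatMap]

theorem initState_mem_deg (i : ℕ) (hi : i < n) : (initState adj).mem (i + 1) = deg adj i := by
  rw [initState_mem, encode, List.getD_cons_succ, List.getD_append _ _ _ _ (by simpa using hi),
    List.getD_eq_getElem _ _ (by simpa using hi), List.getElem_ofFn]
  exact (deg_val adj ⟨i, hi⟩).symm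

theorem off_deg : off (deg adj) n = ∑ i : Fin n, (adj i).length := by
  rw [off, Finset.sum_range]
  exact Finset.sum_congr rfl fun i _ => deg_val adj i

variable {adj}

theorem IsAdjLists.off_deg_eq (h : IsAdjLists G adj) : off (deg adj) n = 2 * G.edgeSet.ncard := by
  classical
  rw [off_deg, Set.ncard_eq_toFinset_card', ← SimpleGraph.edgeFinset,
    ← SimpleGraph.sum_degrees_eq_twice_card_edges]
  refine Finset.sum_congr rfl fun i _ => ?_
  rw [← SimpleGraph.card_neighborFinset_eq_degree, ← List.toFinset_card_of_nodup (h i).1]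
  congr 1
  ext j
  rw [List.mem_toFinset, (h i).2, SimpleGraph.mem_neighborFinset]

theorem IsAdjLists.length_lt (h : IsAdjLists G adj) (i : Fin n) : (adj i).length < n := by
  have hi : i ∉ adj i := by simp [(h i).2]
  have : (i :: adj i).Nodup := List.nodup_cons.2 ⟨hi, (h i).1⟩
  simpa using this.length_le_card

theorem IsAdjLists.off_deg_le (h : IsAdjLists G adj) : off (deg adj) n ≤ n * n := by
  rw [off_deg]
  calc ∑ i : Fin n, (adj i).length ≤ ∑ _i : Fin n, n :=
        Finset.sum_le_sum fun i _ => (h.length_lt i).le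
    _ = n * n := by simp

theorem IsAdjLists.input (h : IsAdjLists G adj) {W base : ℕ} (hbase : base = 1 + (n * n + n))
    (hW : base + 10 * 2 ^ (4 * off (deg adj) n).size +
      2 * (2 ^ (4 * off (deg adj) n).size * 2 ^ (4 * off (deg adj) n).size) + 10 * n + 100 ≤ W) :
    Input W n base (deg adj) (closedNbrs adj) (initState adj).mem := by
  have hle := h.off_deg_le
  refine ⟨rfl, initState_mem_deg adj, fun i => rfl, fun i hi r hr => ?_, hbase, by omega,
    fun a ha => ?_, hW⟩
  · rw [show 1 + (n + off (deg adj) i) + r = 1 + n + (off (deg adj) i + r) by omega,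
      initState_mem_add]
    exact getD_flatten _ i r hr
  · obtain ⟨x, rfl⟩ := Nat.exists_eq_add_of_le (show 1 + n ≤ a by omega)
    rw [initState_mem_add]
    refine List.getD_eq_default _ _ ?_
    rw [List.length_flatten, List.map_ofFn, List.sum_ofFn]
    have := off_deg adj
    simp only [Function.comp_apply, List.length_map]
    omega

theorem edist_le_two_iff {u v : Fin n} :
    G.edist u v ≤ 2 ↔ ∃ x, (x = u ∨ G.Adj u x) ∧ (x = v ∨ G.Adj v x) := by
  rw [← not_lt, SimpleGraph.two_lt_edist_iff, ← Set.not_nonempty_iff_eq_empty]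
  simp only [not_and, not_not]
  constructor
  · intro h
    by_cases huv : u = v
    · exact ⟨u, Or.inl rfl, Or.inl huv⟩
    by_cases hadj : G.Adj u v
    · exact ⟨v, Or.inr hadj, Or.inl rfl⟩
    obtain ⟨x, hx⟩ := h huv hadj
    exact ⟨x, Or.inr hx.1, Or.inr hx.2⟩
  · rintro ⟨x, rfl | hx, rfl | hx'⟩ hne hadj
    · exact absurd rfl hne
    · exact absurd hx'.symm hadj
    · exact absurd hx hadj
    · exact ⟨x, hx, hx'⟩

/-- The number of vertices at distance at most `2` from `i`, and `0` if `i` is not a vertex. -/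
noncomputable def ballTwo (G : SimpleGraph (Fin n)) (i : ℕ) : ℕ :=
  if h : i < n then {v | G.edist ⟨i, h⟩ v ≤ 2}.ncard else 0

theorem ballTwo_val (i : Fin n) : ballTwo G i = {v | G.edist i v ≤ 2}.ncard := by
  rw [ballTwo, dif_pos i.2]

theorem ballTwo_le (i : ℕ) : ballTwo G i ≤ n := by
  rw [ballTwo]
  split_ifs with h
  · exact (Set.ncard_le_card _).trans (by simp)
  · exact Nat.zero_le n

theorem IsAdjLists.eq_of_deg_eq_zero (h : IsAdjLists G adj) {i v : Fin n} (hi : deg adj i = 0)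
    (hv : G.edist i v ≤ 2) : v = i := by
  have hno : ∀ x, ¬ G.Adj i x := by
    intro x hx
    rw [deg_val, List.length_eq_zero_iff] at hi
    rw [← (h i).2, hi] at hx
    exact List.not_mem_nil hx
  obtain ⟨x, rfl | hx, rfl | hx'⟩ := edist_le_two_iff.1 hv
  · rfl
  · exact absurd hx'.symm (hno v)
  · exact absurd hx (hno _)
  · exact absurd hx (hno _)

theorem IsAdjLists.ballTwo_of_isolated (h : IsAdjLists G adj) {i : ℕ} (hi : i < n)
    (hd : deg adj i = 0) : ballTwo G i = 1 := by
  rw [ballTwo, dif_pos hi, Set.ncard_eq_one]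
  refine ⟨⟨i, hi⟩, Set.eq_singleton_iff_unique_mem.2 ⟨by simp, fun v hv => ?_⟩⟩
  exact h.eq_of_deg_eq_zero (i := ⟨i, hi⟩) hd hv

/-- The complete Morton order finds all pairs at distance at most `2`. -/
theorem IsAdjLists.card_met (h : IsAdjLists G adj) {i : ℕ} (hi : i < n) (hd : deg adj i ≠ 0) :
    (met n (deg adj) (closedNbrs adj) (4 ^ (4 * off (deg adj) n).size) i).card = ballTwo G i := by
  classical
  rw [ballTwo, dif_pos hi, Set.ncard_eq_toFinset_card', ← Finset.card_map Fin.valEmbedding]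
  congr 1
  ext k
  rw [mem_met, Finset.mem_map]
  simp only [Set.mem_toFinset, Set.mem_ofPred_eq, Fin.valEmbedding_apply]
  constructor
  · rintro ⟨t, -, hit⟩
    refine ⟨⟨k, hit.2.1.1⟩, ?_, rfl⟩
    obtain ⟨x, hx, hxe⟩ := (exists_closedNbrs_eq_iff adj ⟨i, hi⟩ _).1
      ⟨evenBits t - st (deg adj) i, by have := hit.1.2.2.2; simp only; omega, rfl⟩
    obtain ⟨y, hy, hye⟩ := (exists_closedNbrs_eq_iff adj ⟨k, hit.2.1.1⟩ _).1
      ⟨evenBits (t / 2) - st (deg adj) k, by have := hit.2.1.2.2.2; simp only; omega, rfl⟩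
    have hxy : x = y := Fin.ext (hxe.trans (hit.2.2.trans hye.symm))
    subst hxy
    exact edist_le_two_iff.2 ⟨x, by rwa [(h _).2] at hx, by rwa [(h _).2] at hy⟩
  · rintro ⟨v, hv, rfl⟩
    have hdv : deg adj v ≠ 0 := by
      intro hdv
      rw [SimpleGraph.edist_comm] at hv
      rw [← h.eq_of_deg_eq_zero hdv hv] at hdv
      exact hd hdv
    obtain ⟨x, hx, hx'⟩ := edist_le_two_iff.1 hv
    rw [← (h _).2] at hx hx'
    obtain ⟨r, hr, hre⟩ := (exists_closedNbrs_eq_iff adj ⟨i, hi⟩ x).2 ⟨x, hx, rfl⟩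
    obtain ⟨r', hr', hre'⟩ := (exists_closedNbrs_eq_iff adj v x).2 ⟨x, hx', rfl⟩
    have ho : Occ n (deg adj) (st (deg adj) i + r) i :=
      ⟨hi, hd, Nat.le_add_right _ _, Nat.add_le_add_left hr _⟩
    have ho' : Occ n (deg adj) (st (deg adj) v + r') v :=
      ⟨v.2, hdv, Nat.le_add_right _ _, Nat.add_le_add_left hr' _⟩
    have hbig : 4 * off (deg adj) n < 2 ^ (4 * off (deg adj) n).size := Nat.lt_size_self _
    obtain ⟨t, ht, h₁, h₂⟩ := exists_evenBits (ho.lt_off.trans hbig) (ho'.lt_off.trans hbig)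
    refine ⟨t, ht, ?_⟩
    rw [Hit, h₁, h₂, Nat.add_sub_cancel_left, Nat.add_sub_cancel_left]
    exact ⟨ho, ho', hre.trans hre'.symm⟩

end

/-! ### The run of the whole program -/

/-- What is known when the common part of the algorithms ends. -/
structure CoreEnd {n : ℕ} (G : SimpleGraph (Fin n)) (adj : Fin n → List (Fin n))
    (base bT bS : ℕ) (t : List ℕ) (s : State) : Prop where
  one : s.reg rOne = 1
  two : s.reg rTwo = 2
  reg_n : s.reg rN = n
  reg_bt : s.reg rBT = bT
  reg_bs : s.reg rBS = bS
  reg_c1 : s.reg rC1 = ((Finset.range n).filter fun j => deg adj j + 1 = n).card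
  reg_c2 : s.reg rC2 = ((Finset.range n).filter fun j => ballTwo G j = n).card
  rows : Rows n bT bS (deg adj) (ballTwo G) n s.mem
  trace : ∃ t₁ t₂ t₃, t = 0 :: (t₁ ++ (t₂ ++ t₃)) ∧
    Scan ![1, 1 + n, base] t₁
      ![n + 1, 1 + n + off (deg adj) n, base + 5 * (4 * off (deg adj) n)] ∧
    Pieced (roundAddrs n (deg adj) base) (4 ^ (4 * off (deg adj) n).size) t₂ ∧
    Scan ![1, base, bT, bS] t₃
      ![n + 1, base + 5 * (4 * off (deg adj) n), bT + 3 * n, bS + 4 * n]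

section

variable {n W base bT bS : ℕ} {G : SimpleGraph (Fin n)} {adj : Fin n → List (Fin n)}

theorem wp_setup {Q : List ℕ → State → Prop} {d : ℕ → ℕ} {cl : ℕ → ℕ → ℕ} {s : State}
    (hin : Input W n base d cl s.mem)
    (hQ : ∀ s' : State, FillInv n base d cl s.mem 0 [] s' → Q [0] s') : wp W setup Q s := by
  have hword := hin.word
  have hbase := hin.base_eq
  have hone := ite_one_lt (W := W) (by omega)
  have hb : 1 + (n * n + n) = base := by omega
  have hcomm : n + n * n = n * n + n := Nat.add_comm _ _
  simp (disch := decide) only [setup, wp_block_cons, wp_block_nil, wp_op, wp_const, wp_load,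
    State.reg_setReg_self, State.reg_setReg_of_ne, State.mem_setReg, BinOp.eval, hin.size, hcomm,
    hb, hone, true_and, List.nil_append, List.append_nil]
  refine ⟨by omega, by omega, by omega, by omega, by omega, by omega, by omega, by omega, by omega,
    by omega, ?_⟩
  refine hQ _ ⟨⟨?_, ?_, ?_, ?_, ?_, ?_⟩, ?_, ?_, ?_, hin.filled, ?_⟩
  all_goals try simp (disch := decide) only [State.reg_setReg_self, State.reg_setReg_of_ne]
  · simp [off]
  · exact .nil (vec3_le.2 (by simp [off]))

theorem wp_core {Q : List ℕ → State → Prop} (h : IsAdjLists G adj)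
    (hin : Input W n base (deg adj) (closedNbrs adj) (initState adj).mem)
    (hT : bT = base + 5 * 2 ^ (4 * off (deg adj) n).size) (hS : bS = bT + n + n + n)
    (hQ : ∀ t s', CoreEnd G adj base bT bS t s' → Q t s') : wp W core Q (initState adj) := by
  have hle := hin.le_base
  rw [core, wp_block_cons]
  refine wp_setup hin fun s₀ h₀ => ?_
  rw [wp_block_cons]
  refine wp_fill_loop hin h₀ fun t₁ s₁ h₁ => ?_
  rw [wp_block_cons]
  refine wp_join h₁.consts hin h₁.mem h₁.reg_o fun t₂ s₂ h₂ => ?_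
  rw [wp_block_cons]
  refine wp_output (ball := ballTwo G) hin hT hS ?_ ?_ ?_ (fun j _ => ballTwo_le j) ?_ h₂.consts
    h₂.reg_w fun t₃ s₃ h₃ => ?_
  · intro j hj
    rw [h₂.mem.same _ fun k _ _ => by omega, h₁.mem.low _ (by omega), initState_mem_deg adj j hj]
  · intro j hj hd
    rw [h₂.mem.cnt j hj hd, h.card_met hj hd]
  · exact fun j hj hd => h.ballTwo_of_isolated hj hd
  · intro j hj
    exact (deg_val adj ⟨j, hj⟩).trans_le (h.length_lt _).le
  · rw [wp_block_nil, List.append_nil, List.singleton_append]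
    exact hQ _ _ ⟨h₃.consts.one, h₃.consts.two, h₃.consts.n, h₃.reg_bt, h₃.reg_bs, h₃.reg_c1,
      h₃.reg_c2, h₃.rows, t₁, t₂, t₃, rfl, h₁.scan, h₂.pieced, h₃.scan⟩

/-! ### The number of cache misses -/

theorem CoreEnd.exists_cost {t : List ℕ} {s : State} (h : CoreEnd G adj base bT bS t s)
    {e M B : ℕ} (he : off (deg adj) n = 2 * e) (hB : 1 ≤ B) (hM : 32 * B ≤ M) :
    ∃ q, Cost M B t q ∧
      q * B * M ≤ 409600 * e ^ 2 + (242 * e + 10 * n + 100 * B) * M := by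
  obtain ⟨t₁, t₂, t₃, rfl, h₁, h₂, h₃⟩ := h.trace
  obtain ⟨q₁, c₁, e₁⟩ := h₁.exists_cost hB (show 3 * B ≤ M by omega)
  obtain ⟨q₂, c₂, e₂⟩ := morton_cost h₂ hB hM
  obtain ⟨q₃, c₃, e₃⟩ := h₃.exists_cost hB (show 4 * B ≤ M by omega)
  have c₀ : Cost M B [0] 1 := by
    refine cost_of_lines {0} (by rw [Finset.card_singleton]; omega) fun a ha => ?_
    rw [List.mem_singleton.1 ha, Nat.zero_div]
    exact Finset.mem_singleton_self 0
  refine ⟨1 + (q₁ + (q₂ + q₃)), c₀.append (c₁.append (c₂.append c₃)), ?_⟩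
  simp only [Fin.sum_univ_succ, Fin.sum_univ_zero, Matrix.cons_val_zero, Matrix.cons_val_succ,
    Nat.add_zero] at e₁ e₃
  rw [he] at e₁ e₂ e₃
  have h4 : (4 : ℕ) ^ (4 * (2 * e)).size = 2 ^ (4 * (2 * e)).size * 2 ^ (4 * (2 * e)).size := by
    rw [← mul_pow]; norm_num
  rw [h4] at e₂
  have hBM : 32 ≤ B * M := by nlinarith
  have hw : 2 ^ (4 * (2 * e)).size ≤ 16 * e + 1 ∧
      2 ^ (4 * (2 * e)).size * 2 ^ (4 * (2 * e)).size ≤ 256 * e ^ 2 + 1 := by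
    rcases Nat.eq_zero_or_pos e with rfl | hpos
    · simp
    · have := size_pow_le_two_mul (x := 4 * (2 * e)) (by omega)
      exact ⟨by omega, by nlinarith [Nat.mul_le_mul this this]⟩
  generalize 2 ^ (4 * (2 * e)).size = w at *
  have a₁ : (q₁ + q₃) * B ≤ 82 * e + 9 * n + 14 * B := by linarith
  have a₂ : (q₁ + q₃) * B * M ≤ (82 * e + 9 * n + 14 * B) * M := Nat.mul_le_mul_right _ a₁
  have a₃ : (10 * w + 16 * B) * M ≤ (160 * e + 26 * B) * M := Nat.mul_le_mul_right _ (by omega)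
  have a₄ := hw.2
  have a₅ : 0 ≤ n * M := Nat.zero_le _
  ring_nf at a₂ a₃ a₄ a₅ e₂ hBM ⊢
  linarith

/-- The bound on the misses in the form of the theorem: `|E| / B` is at most `|E| lg |E| / B` if
`|E| ≥ 2`, and at most `1` otherwise. -/
theorem io_bounds {q n e M B : ℕ} (hB : 1 ≤ B) (hM : B ≤ M)
    (h : q * B * M ≤ 409600 * e ^ 2 + (242 * e + 10 * n + 100 * B) * M) :
    (q : ℝ) ≤ (409600 : ℕ) * (ioBound e M B + (n : ℝ) / (B : ℝ) + 1) ∧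
      ∀ K : ℕ, n ≤ K * e → 2 ≤ e → B ≤ e →
        (q : ℝ) ≤ (409600 : ℕ) * ((K : ℝ) + 1) * ioBound e M B := by
  have hB' : (0 : ℝ) < B := by exact_mod_cast hB
  have hM' : (0 : ℝ) < M := by exact_mod_cast hB.trans hM
  have hq : (q : ℝ) ≤ 409600 * ((e : ℝ) ^ 2 / (M * B)) + 242 * (e / B) + 10 * (n / B) + 100 := by
    have h' : (q : ℝ) * B * M ≤ 409600 * e ^ 2 + (242 * e + 10 * n + 100 * B) * M := by
      exact_mod_cast h
    have : (q : ℝ) ≤ (409600 * e ^ 2 + (242 * e + 10 * n + 100 * B) * M) / (B * M) := by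
      rw [le_div_iff₀ (by positivity)]
      linarith
    refine this.trans (le_of_eq ?_)
    field_simp
    ring
  have hx : (0 : ℝ) ≤ (e : ℝ) ^ 2 / (M * B) := by positivity
  have hlog : 2 ≤ e → (e : ℝ) / B ≤ e * Real.logb 2 e / B := by
    intro he
    have he' : (2 : ℝ) ≤ e := by exact_mod_cast he
    have : 1 ≤ Real.logb 2 e := by
      rw [Real.le_logb_iff_rpow_le (by norm_num) (by linarith)]
      simpa using he'
    gcongr
    nlinarith
  have hn : (0 : ℝ) ≤ (n : ℝ) / B := by positivity
  push_cast
  rw [ioBound]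
  constructor
  · by_cases he : 2 ≤ e
    · have := hlog he
      have he0 : (0 : ℝ) ≤ (e : ℝ) / B := by positivity
      linarith
    · have h₁ : (e : ℝ) / B ≤ 1 := by
        rw [div_le_one hB']
        exact_mod_cast (show e ≤ B by omega)
      have h₂ : (e : ℝ) * Real.logb 2 e / B = 0 := by
        have : e = 0 ∨ e = 1 := by omega
        rcases this with rfl | rfl <;> simp
      linarith
  · intro K hK he hBe
    have h₁ := hlog he
    have h₂ : (n : ℝ) / B ≤ K * (e / B) := by
      rw [← mul_div_assoc]
      gcongr
      exact_mod_cast hK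
    have h₃ : (1 : ℝ) ≤ e / B := by
      rw [one_le_div hB']
      exact_mod_cast hBe
    have hK0 : (0 : ℝ) ≤ K := Nat.cast_nonneg K
    have h₄ : (K : ℝ) * (e / B) ≤ K * (e * Real.logb 2 e / B) := by gcongr
    have h₅ : (0 : ℝ) ≤ K * ((e : ℝ) ^ 2 / (M * B)) := by positivity
    have h₆ : (0 : ℝ) ≤ K * (e * Real.logb 2 e / B) := le_trans (by positivity) h₄
    linarith

/-- It remains to compute the result from the output of the common part, in registers. -/
theorem solvable_of_finish {post : (n : ℕ) → SimpleGraph (Fin n) → State → Prop} (p : Prog)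
    (hp : ∀ {n W base bT bS : ℕ} {G : SimpleGraph (Fin n)} {adj : Fin n → List (Fin n)}
      {t : List ℕ} {s : State}, IsAdjLists G adj → CoreEnd G adj base bT bS t s → bT < W → bS < W →
      3 < W → wp W p (fun t' s' => t' = [] ∧ post n G s') s) :
    CacheObliviouslySolvable post := by
  refine ⟨.seq core p, 12, 32, 409600, fun n G adj h => ?_⟩
  have hoff := h.off_deg_eq
  generalize G.edgeSet.ncard = e at *
  obtain ⟨base, hbase⟩ : ∃ base, base = 1 + (n * n + n) := ⟨_, rfl⟩
  obtain ⟨w, hw⟩ : ∃ w, w = 2 ^ (4 * off (deg adj) n).size := ⟨_, rfl⟩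
  have hword : base + 10 * w + 2 * (w * w) + 10 * n + 100 ≤ (n + e + 2) ^ 12 := by
    have hwe : w ≤ 16 * e + 1 := by
      rw [hw, hoff]
      rcases Nat.eq_zero_or_pos e with h0 | hpos
      · simp [h0]
      · have := size_pow_le_two_mul (x := 4 * (2 * e)) (by omega)
        omega
    obtain ⟨x, hx⟩ : ∃ x, x = n + e + 2 := ⟨_, rfl⟩
    have h₁ : 2 ^ 10 * x ^ 2 ≤ x ^ 12 := by
      calc 2 ^ 10 * x ^ 2 ≤ x ^ 10 * x ^ 2 := by gcongr; omega
        _ = x ^ 12 := by ring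
    have h₂ : n * n ≤ x * x := Nat.mul_le_mul (by omega) (by omega)
    have h₃ : w * w ≤ (16 * x) * (16 * x) := Nat.mul_le_mul (by omega) (by omega)
    have h₄ : 2 * x ≤ x * x := Nat.mul_le_mul_right _ (by omega)
    rw [← hx]
    refine le_trans ?_ h₁
    rw [hbase]
    nlinarith
  generalize (n + e + 2) ^ 12 = W at *
  have hin := h.input hbase (hw ▸ hword)
  have hrun : wp W (.seq core p)
      (fun t s => post n G s ∧ ∃ s', CoreEnd G adj base (base + 5 * w)
        (base + 5 * w + n + n + n) t s') (initState adj) := by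
    rw [wp_seq]
    refine wp_core (bT := base + 5 * w) h hin (by rw [hw]) rfl fun t s hs => ?_
    refine (hp h hs (by omega) (by omega) (by omega)).mono ?_
    rintro t' s' ⟨rfl, hpost⟩
    rw [List.append_nil]
    exact ⟨hpost, s, hs⟩
  obtain ⟨t, s, hexec, hpost, s', hs'⟩ := hrun.exists_exec
  refine ⟨t, s, hexec, hpost, fun M B hB hM => ?_⟩
  obtain ⟨q, hq, hqe⟩ := hs'.exists_cost hoff hB hM
  obtain ⟨q', hq', hserve⟩ := hq ∅
  have hq'e : q' * B * M ≤ q * B * M := by gcongr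
  have hfin := io_bounds hB (show B ≤ M by omega) (hq'e.trans hqe)
  exact ⟨q', hserve, hfin⟩

/-! ### The four tasks -/

theorem IsAdjLists.ncard_le_one (h : IsAdjLists G adj) (i : Fin n) :
    {v | G.edist i v ≤ 1}.ncard = deg adj i + 1 := by
  classical
  have hi : i ∉ (adj i).toFinset := by simp [(h i).2]
  rw [deg_val, ← List.toFinset_card_of_nodup (h i).1, ← Finset.card_insert_of_notMem hi,
    ← Set.ncard_coe_finset]
  congr 1
  ext v
  simp [SimpleGraph.edist_le_one_iff_adj_or_eq, (h i).2, or_comm, eq_comm]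

theorem ncard_eq_card_iff (s : Set (Fin n)) : s.ncard = n ↔ ∀ v, v ∈ s := by
  rw [← Set.eq_univ_iff_forall]
  constructor
  · intro h
    exact Set.eq_of_subset_of_ncard_le (Set.subset_univ s) (by simp [Set.ncard_univ, h])
  · rintro rfl
    simp [Set.ncard_univ]

theorem IsAdjLists.eccent_le_one_iff (h : IsAdjLists G adj) (i : Fin n) :
    G.eccent i ≤ 1 ↔ deg adj i + 1 = n := by
  rw [← h.ncard_le_one, ncard_eq_card_iff, SimpleGraph.eccent_le_iff]
  rfl

theorem eccent_le_two_iff (i : Fin n) : G.eccent i ≤ 2 ↔ ballTwo G i = n := by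
  rw [ballTwo_val, ncard_eq_card_iff, SimpleGraph.eccent_le_iff]
  rfl

theorem ediam_le_iff_card {f : ℕ → ℕ} {k : ℕ∞} (hf : ∀ i : Fin n, G.eccent i ≤ k ↔ f i = n) :
    G.ediam ≤ k ↔ ((Finset.range n).filter fun j => f j = n).card = n := by
  conv_rhs => rhs; rw [← Finset.card_range n]
  rw [Finset.card_filter_eq_iff, SimpleGraph.ediam_le_iff]
  constructor
  · intro h j hj
    exact (hf ⟨j, Finset.mem_range.1 hj⟩).1 ((SimpleGraph.eccent_le_iff _ _).2 (h _))
  · intro h u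
    exact (SimpleGraph.eccent_le_iff _ _).1 ((hf u).2 (h u (Finset.mem_range.2 u.2)))

theorem radius_le_iff_card [Nonempty (Fin n)] {f : ℕ → ℕ} {k : ℕ∞}
    (hf : ∀ i : Fin n, G.eccent i ≤ k ↔ f i = n) :
    G.radius ≤ k ↔ 0 < ((Finset.range n).filter fun j => f j = n).card := by
  rw [Finset.card_pos]
  constructor
  · intro h
    obtain ⟨u, hu⟩ := G.exists_eccent_eq_radius
    exact ⟨u, Finset.mem_filter.2 ⟨Finset.mem_range.2 u.2, (hf u).1 (hu.trans_le h)⟩⟩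
  · rintro ⟨j, hj⟩
    rw [Finset.mem_filter, Finset.mem_range] at hj
    exact SimpleGraph.radius_le_eccent.trans ((hf ⟨j, hj.1⟩).2 hj.2)

theorem returns123_of_le_iff {x : ℕ∞} {p₁ p₂ : Prop} [Decidable p₁] [Decidable p₂] {s : State}
    (hx : x ≠ 0) (h₁ : x ≤ 1 ↔ p₁) (h₂ : x ≤ 2 ↔ p₂)
    (hs : s.reg 0 = 3 - (if p₂ then 1 else 0) - (if p₁ then 1 else 0)) : Returns123 x s := by
  have hpos : 1 ≤ x := Order.one_le_iff_pos.2 (pos_iff_ne_zero.2 hx)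
  by_cases c₁ : p₁
  · have c₂ : p₂ := h₂.1 ((h₁.2 c₁).trans (by norm_num))
    rw [if_pos c₁, if_pos c₂] at hs
    exact Or.inl ⟨le_antisymm (h₁.2 c₁) hpos, hs⟩
  · have hlt : 1 < x := lt_of_not_ge fun h => c₁ (h₁.1 h)
    have h2 : 2 ≤ x := by
      have := Order.add_one_le_of_lt hlt
      rwa [one_add_one_eq_two] at this
    by_cases c₂ : p₂
    · rw [if_neg c₁, if_pos c₂] at hs
      exact Or.inr (Or.inl ⟨le_antisymm (h₂.2 c₂) h2, hs⟩)
    · rw [if_neg c₁, if_neg c₂] at hs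
      have hlt : 2 < x := lt_of_not_ge fun h => c₂ (h₂.1 h)
      have := Order.add_one_le_of_lt hlt
      rw [two_add_one_eq_three] at this
      exact Or.inr (Or.inr ⟨this, hs⟩)

theorem CoreEnd.returnsT {t : List ℕ} {s s' : State} (h : IsAdjLists G adj)
    (hs : CoreEnd G adj base bT bS t s) (hm : s'.mem = s.mem) (h₀ : s'.reg 0 = bT) :
    ReturnsT n G s' := by
  intro i j
  rw [hm, h₀]
  obtain ⟨r₀, r₁, r₂⟩ := hs.rows.rowT i i.2
  fin_cases j
  · have zero_eq : {v | G.edist i v ≤ 0}.ncard = 1 := by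
      rw [Set.ncard_eq_one]
      exact ⟨i, by ext v; simp [eq_comm (a := v)]⟩
    simpa using r₀.trans zero_eq.symm
  · simpa [h.ncard_le_one] using r₁
  · simpa [ballTwo_val] using r₂

theorem CoreEnd.returnsS {t : List ℕ} {s s' : State} (h : IsAdjLists G adj)
    (hs : CoreEnd G adj base bT bS t s) (hm : s'.mem = s.mem) (h₀ : s'.reg 0 = bS) :
    ReturnsS n G s' := by
  intro i
  rw [hm, h₀]
  obtain ⟨r₀, r₁, r₂, r₃⟩ := hs.rows.rowS i i.2
  have one_eq : {v | G.edist i v = 1}.ncard = deg adj i := by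
    classical
    rw [deg_val, ← List.toFinset_card_of_nodup (h i).1, ← Set.ncard_coe_finset]
    congr 1
    ext v
    simp [SimpleGraph.edist_eq_one_iff_adj, (h i).2]
  have lt_iff : ∀ v, G.edist i v < 2 ↔ G.edist i v ≤ 1 := by
    intro v
    rw [← one_add_one_eq_two, ENat.lt_add_one_iff (by simp)]
  have lt_iff' : ∀ v, G.edist i v < 3 ↔ G.edist i v ≤ 2 := by
    intro v
    rw [← two_add_one_eq_three, ENat.lt_add_one_iff (by simp)]
  have two_eq : {v | G.edist i v = 2}.ncard = ballTwo G i - (deg adj i + 1) := by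
    rw [ballTwo_val, ← h.ncard_le_one, ← Set.ncard_sdiff]
    · congr 1
      ext v
      simp only [Set.mem_ofPred_eq, Set.mem_sdiff, ← lt_iff, not_lt]
      exact le_antisymm_iff
    · intro v hv
      exact le_trans (show G.edist i v ≤ 1 from hv) (show (1 : ℕ∞) ≤ 2 by norm_num)
  have three_le : {v | 3 ≤ G.edist i v}.ncard = n - ballTwo G i := by
    have : {v | 3 ≤ G.edist i v} = {v | G.edist i v ≤ 2}ᶜ := by
      ext v
      simp only [Set.mem_ofPred_eq, Set.mem_compl_iff, ← lt_iff', not_lt]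
    rw [ballTwo_val, this, Set.ncard_compl]
    simp
  refine ⟨fun j => ?_, r₃.trans three_le.symm⟩
  fin_cases j
  · have zero_eq : {v | G.edist i v = 0}.ncard = 1 := by
      rw [Set.ncard_eq_one]
      exact ⟨i, by ext v; simp [eq_comm (a := v)]⟩
    simpa using r₀.trans zero_eq.symm
  · simpa using r₁.trans one_eq.symm
  · simpa [two_eq] using r₂

end

theorem solvable_returnsT : CacheObliviouslySolvable ReturnsT := by
  refine solvable_of_finish (block [.const rK 0, .op .add rOut rBT rK])
    fun h hs hT hS hW => ?_
  simp (disch := decide) only [wp_block_cons, wp_block_nil, wp_const, wp_op, BinOp.eval,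
    State.reg_setReg_self, State.reg_setReg_of_ne, hs.reg_bt, Nat.add_zero]
  refine ⟨by omega, hT, rfl, hs.returnsT h rfl ?_⟩
  simp (disch := decide)

theorem solvable_returnsS : CacheObliviouslySolvable ReturnsS := by
  refine solvable_of_finish (block [.const rK 0, .op .add rOut rBS rK])
    fun h hs hT hS hW => ?_
  simp (disch := decide) only [wp_block_cons, wp_block_nil, wp_const, wp_op, BinOp.eval,
    State.reg_setReg_self, State.reg_setReg_of_ne, hs.reg_bs, Nat.add_zero]
  refine ⟨by omega, hS, rfl, hs.returnsS h rfl ?_⟩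
  simp (disch := decide)

theorem solvable_ediam :
    CacheObliviouslySolvable fun n G s => 2 ≤ n → Returns123 G.ediam s := by
  refine solvable_of_finish (block [.op .eq rK rC1 rN, .op .eq rE rC2 rN, .op .add rOut rOne rTwo,
    .op .sub rOut rOut rE, .op .sub rOut rOut rK]) fun {n W _ _ _ G adj _ s} h hs hT hS hW => ?_
  have hone := ite_one_lt (W := W) (by omega)
  simp (disch := decide) only [wp_block_cons, wp_block_nil, wp_op, BinOp.eval,
    State.reg_setReg_self, State.reg_setReg_of_ne, hs.one, hs.two, hs.reg_c1, hs.reg_c2, hs.reg_n,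
    hone, true_and]
  refine ⟨by omega, by omega, by omega, rfl, fun hn => ?_⟩
  have : Nontrivial (Fin n) := Fin.nontrivial_iff_two_le.2 hn
  refine returns123_of_le_iff SimpleGraph.ediam_ne_zero
    (ediam_le_iff_card (f := fun j => deg adj j + 1) h.eccent_le_one_iff)
    (ediam_le_iff_card eccent_le_two_iff) ?_
  simp (disch := decide) only [State.reg_setReg_self]

theorem solvable_radius :
    CacheObliviouslySolvable fun n G s => 2 ≤ n → Returns123 G.radius s := by
  refine solvable_of_finish (block [.const rA 0, .op .lt rK rA rC1, .op .lt rE rA rC2,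
    .op .add rOut rOne rTwo, .op .sub rOut rOut rE, .op .sub rOut rOut rK])
    fun {n W _ _ _ G adj _ s} h hs hT hS hW => ?_
  have hone := ite_one_lt (W := W) (by omega)
  simp (disch := decide) only [wp_block_cons, wp_block_nil, wp_op, wp_const, BinOp.eval,
    State.reg_setReg_self, State.reg_setReg_of_ne, hs.one, hs.two, hs.reg_c1, hs.reg_c2,
    hone, true_and]
  refine ⟨by omega, by omega, by omega, by omega, rfl, fun hn => ?_⟩
  have : Nontrivial (Fin n) := Fin.nontrivial_iff_two_le.2 hn
  refine returns123_of_le_iff SimpleGraph.radius_ne_zero_of_nontrivial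
    (radius_le_iff_card (f := fun j => deg adj j + 1) h.eccent_le_one_iff)
    (radius_le_iff_card eccent_le_two_iff) ?_
  simp (disch := decide) only [State.reg_setReg_self]

end CacheOblivious

theorem mainTheorem1 :
    CacheOblivious.CacheObliviouslySolvable CacheOblivious.ReturnsT ∧
    CacheOblivious.CacheObliviouslySolvable CacheOblivious.ReturnsS ∧
    CacheOblivious.CacheObliviouslySolvable
      (fun n G s => 2 ≤ n → CacheOblivious.Returns123 G.ediam s) ∧
    CacheOblivious.CacheObliviouslySolvable
      (fun n G s => 2 ≤ n → CacheOblivious.Returns123 G.radius s) :=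
  ⟨CacheOblivious.solvable_returnsT, CacheOblivious.solvable_returnsS,
    CacheOblivious.solvable_ediam, CacheOblivious.solvable_radius⟩
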